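/- Let $m\ge 1$ and let $e_1,\dots,e_m$ be the generators of the Clifford algebra $\mathbb{R}_{0,m}$ (scalars extended to $\mathbb{C}$), $e_je_k+e_ke_j=-2\delta_{jk}$. Let $\underline{\partial}=\sum_j e_j\partial_{x_j}$ be the Dirac operator on $\mathbb{R}^m$, $\Delta_m=-\underline\partial^2$ the Laplace operator, $r=|\underline{x}|$ and $\underline{\omega}=\underline{x}/|\underline{x}|$, $\underline{x}=\sum_j x_je_j$. For $\lambda\in\mathbb{C}$ let $T_\lambda=\mathrm{Fp}\,r^\lambda$ and $U_\lambda=\mathrm{Fp}\,r^\lambda\underline{\omega}$ be the tempered distributions on $\mathbb{R}^m$ defined by Hadamard's finite part in spherical coordinates, i.e. $\langle T_\lambda,\phi\rangle=\langle\mathrm{Fp}\,r_+^{\lambda+m-1},\int_{S^{m-1}}\phi(r\underline\omega)\,dS(\underline\omega)\rangle$ and $\langle U_\lambda,\phi\rangle=\langle\mathrm{Fp}\,r_+^{\lambda+m-1},\int_{S^{m-1}}\underline\omega\,\phi(r\underline\omega)\,dS(\underline\omega)\rangle$, and let $$T^*_\lambda=\pi^{\frac{\lambda+m}{2}}\frac{T_\lambda}{\Gamma(\frac{\lambda+m}{2})}\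 \ (\lambda\ne -m-2l),\qquad T^*_{-m-2l}=\frac{\pi^{\frac m2-l}}{2^{2l}\Gamma(\frac m2+l)}(-\Delta_m)^l\delta,$$ $$U^*_\lambda=\pi^{\frac{\lambda+m+1}{2}}\frac{U_\lambda}{\Gamma(\frac{\lambda+m+1}{2})}\ \ (\lambda\ne -m-2l-1),\qquad U^*_{-m-2l-1}=-\frac{\pi^{\frac m2-l}}{2^{2l+1}\Gamma(\frac m2+l+1)}\,\underline{\partial}^{2l+1}\delta,$$ where $l=0,1,2,\dots$. For $\mu\in\mathbb{C}$ put $$\underline{\partial}^{\mu}H=\frac{1-e^{i\pi\mu}}{2}\,\frac{2^{\mu}\Gamma(\frac{m+\mu}{2})}{\pi^{\frac{m-\mu}{2}}}\,T^*_{-m-\mu}-\frac{1+e^{i\pi\mu}}{2}\,\frac{2^{\mu}\Gamma(\frac{m+\mu+1}{2})}{\pi^{\frac{m-\mu+1}{2}}}\,U^*_{-m-\mu},$$ where the first term is omitted when $\mu$ is an even integer and the second when $\mu$ is an odd integer; this is defined for all $\mu$ if $m$ is even, and for $\mu\notin\{-m,-m-1,-m-2,\dots\}$ if $m$ is odd.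 Let ${}^{\mu}\mathcal{H}$ be the convolution operator ${}^{\mu}\mathcal{H}[f]=\underline{\partial}^{\mu}H*f$. Here the convolution $S*T$ of two Clifford-valued tempered distributions is said to exist and to equal the tempered distribution $W$ if, for all $\phi,\psi\in\mathcal{S}(\mathbb{R}^m)$, the convolution integral of the smooth functions $S*\phi$ and $T*\psi$ converges absolutely (component by component) and $(W*\phi)*\psi=(S*\phi)*(T*\psi)$. Let $\mu\in\mathbb{C}$ and, if $m$ is odd, assume that $\mu\ne m+n$ and $\mu\ne -m-n$ for all $n=0,1,2,\dots$. Then $\underline{\partial}^{\mu}H*\underline{\partial}^{-\mu}H$ exists and $$\underline{\partial}^{\mu}H*\underline{\partial}^{-\mu}H=\delta.$$ Hence the distribution $$F_\mu=\frac{1-e^{-i\pi\mu}}{2}\,\frac{2^{-\mu}\Gamma(\frac{m-\mu}{2})}{\pi^{\frac{m+\mu}{2}}}\,T^*_{-m+\mu}-\frac{1+e^{-i\pi\mu}}{2}\,\frac{2^{-\mu}\Gamma(\frac{m-\mu+1}{2})}{\pi^{\frac{m+\mu+1}{2}}}\,U^*_{-m+\mu}$$ (with the same convention for integer $\mu$)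 equals $\underline{\partial}^{-\mu}H$ and is a fundamental solution of ${}^{\mu}\mathcal{H}$, that is, ${}^{\mu}\mathcal{H}[F_\mu]=\delta$. -/

import Mathlib

open scoped SchwartzMap TensorProduct LineDeriv

noncomputable section

namespace HilbertDirac

/-! ### The Clifford algebra and Clifford-valued distributions -/

/-- Euclidean space `ℝ^m`. -/
abbrev Euc (m : ℕ) : Type := EuclideanSpace ℝ (Fin m)

/-- The quadratic form `-(x₁² + ⋯ + x_m²)`, of signature `(0, m)`. -/
abbrev quadForm (m : ℕ) : QuadraticForm ℝ (Fin m → ℝ) :=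
  QuadraticMap.weightedSumSquares ℝ (fun _ : Fin m => (-1 : ℝ))

/-- The universal real Clifford algebra `ℝ_{0,m}` with its scalars extended to `ℂ`. -/
abbrev Cliff (m : ℕ) : Type := ℂ ⊗[ℝ] CliffordAlgebra (quadForm m)

/-- The generators `e_j`; they satisfy `e_j e_k + e_k e_j = -2 δ_{jk}`. -/
def e {m : ℕ} (j : Fin m) : Cliff m :=
  (1 : ℂ) ⊗ₜ[ℝ] CliffordAlgebra.ι (quadForm m) (Pi.single j 1)

/-- Scalar-valued functionals on the Schwartz space `𝓢(ℝ^m)`. -/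
abbrev ScalFunctional (m : ℕ) : Type := 𝓢(Euc m, ℂ) → ℂ

/-- Clifford-valued functionals on the Schwartz space `𝓢(ℝ^m)`. -/
abbrev CliffFunctional (m : ℕ) : Type := 𝓢(Euc m, ℂ) → Cliff m

/-- `u` is a Clifford-valued tempered distribution: each of its scalar components is a tempered
distribution, that is, a continuous linear functional on `𝓢(ℝ^m)`. -/
def IsTempered {m : ℕ} (u : CliffFunctional m) : Prop :=
  ∀ l : Module.Dual ℂ (Cliff m), ∃ U : 𝓢'(Euc m, ℂ), ∀ φ : 𝓢(Euc m, ℂ), l (u φ) = U φ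

/-- The Dirac delta distribution at the origin. -/
def delta (m : ℕ) : CliffFunctional m := fun φ => algebraMap ℂ (Cliff m) (φ 0)

/-- The (left) Dirac operator `∑ e_j ∂_{x_j}` acting on Clifford-valued distributions. -/
def dirac {m : ℕ} (u : CliffFunctional m) : CliffFunctional m := fun φ =>
  -∑ j : Fin m, e j * u (∂_{EuclideanSpace.single j (1 : ℝ)} φ)

/-! ### Convolution -/

/-- The Schwartz function `y ↦ φ (x - y)`. -/
def reflectAt {m : ℕ} (x : Euc m) (φ : 𝓢(Euc m, ℂ)) : 𝓢(Euc m, ℂ) :=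
  SchwartzMap.compSubConstCLM ℂ x
    (SchwartzMap.compCLMOfContinuousLinearEquiv ℂ (ContinuousLinearEquiv.neg ℝ) φ)

theorem reflectAt_apply {m : ℕ} (x y : Euc m) (φ : 𝓢(Euc m, ℂ)) :
    reflectAt x φ y = φ (x - y) := by
  simp [reflectAt]

/-- The regularization `u ∗ φ` of a distribution by a test function:
`(u ∗ φ)(x) = ⟨u, φ (x - ·)⟩`. -/
def regularize {m : ℕ} (u : CliffFunctional m) (φ : 𝓢(Euc m, ℂ)) (x : Euc m) : Cliff m :=
  u (reflectAt x φ)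

/-- `IsConvolution S T W`: the tempered distributions `S` and `T` are convolvable and `S ∗ T = W`,
in the general sense of Schwartz and Shiraishi. For all test functions `φ`, `ψ` the convolution of
the smooth functions `S ∗ φ` and `T ∗ ψ` converges absolutely (component by component), and
`(W ∗ φ) ∗ ψ = (S ∗ φ) ∗ (T ∗ ψ)`. Clifford-valued integrals are taken component by component;
the order of the factors in the Clifford product is that of `S` and `T`. The tempered distribution
`W` is determined by `S` and `T`, as the functions `φ ∗ ψ` are dense in `𝓢(ℝ^m)`. -/
structure IsConvolution {m : ℕ} (S T W : CliffFunctional m) : Prop where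
  tempered_left : IsTempered S
  tempered_right : IsTempered T
  tempered_conv : IsTempered W
  integrable : ∀ (φ ψ : 𝓢(Euc m, ℂ)) (x : Euc m) (l l' : Module.Dual ℂ (Cliff m)),
    MeasureTheory.Integrable
      (fun y : Euc m => l (regularize S φ y) * l' (regularize T ψ (x - y)))
  conv_eq : ∀ (φ ψ : 𝓢(Euc m, ℂ)) (x : Euc m) (l : Module.Dual ℂ (Cliff m)),
    ∫ y : Euc m, l (regularize W φ y) * ψ (x - y) =
      ∫ y : Euc m, l (regularize S φ y * regularize T ψ (x - y))

/-! ### The distributions `T_λ`, `U_λ` and their normalizations -/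

/-- The area `2 π^{m/2} / Γ(m/2)` of the unit sphere in `ℝ^m`. -/
def sphereArea (m : ℕ) : ℝ := 2 * Real.pi ^ ((m : ℝ) / 2) / Real.Gamma ((m : ℝ) / 2)

/-- Surface measure on the unit sphere of `ℝ^m`. -/
abbrev sphereMeasure (m : ℕ) : MeasureTheory.Measure (Metric.sphere (0 : Euc m) 1) :=
  (MeasureTheory.volume : MeasureTheory.Measure (Euc m)).toSphere

/-- The spherical mean `Σ⁽⁰⁾[φ]`, as a function of `r`. -/
def sphMean {m : ℕ} (φ : 𝓢(Euc m, ℂ)) (r : ℝ) : ℂ :=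
  ((sphereArea m : ℂ))⁻¹ * ∫ w, φ (r • (w : Euc m)) ∂(sphereMeasure m)

/-- The `j`-th component of the vector-valued spherical mean `Σ⁽¹⁾[φ]`, as a function of `r`. -/
def sphMeanVec {m : ℕ} (j : Fin m) (φ : 𝓢(Euc m, ℂ)) (r : ℝ) : ℂ :=
  ((sphereArea m : ℂ))⁻¹ *
    ∫ w, (((w : Euc m) j : ℝ) : ℂ) * φ (r • (w : Euc m)) ∂(sphereMeasure m)

/-- Hadamard's finite part `⟨Fp r₊^μ, f⟩` of `∫₀^∞ r^μ f(r) dr`, for `f` smooth at `0` and rapidly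
decreasing. On `(0, 1)` the Taylor polynomial of degree `n - 1` of `f` at `0` is subtracted, where
`n = ⌊-Re μ⌋₊` (so that `Re μ + n > -1`), and the finite part of `∫₀¹ r^{μ+k} dr`
is `1 / (μ + k + 1)`, or `0` in the logarithmic case `μ + k + 1 = 0` (where the quotient below
is `0`). -/
def finitePart (μ : ℂ) (f : ℝ → ℂ) : ℂ :=
  (∫ r in Set.Ioc (0 : ℝ) 1, (r : ℂ) ^ μ *
      (f r - ∑ k ∈ Finset.range ⌊-μ.re⌋₊,
        iteratedDeriv k f 0 / (Nat.factorial k : ℂ) * (r : ℂ) ^ k))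
    + (∫ r in Set.Ioi (1 : ℝ), (r : ℂ) ^ μ * f r)
    + ∑ k ∈ Finset.range ⌊-μ.re⌋₊,
        iteratedDeriv k f 0 / (Nat.factorial k : ℂ) / (μ + k + 1)

/-- `T_λ = Fp r^λ`. -/
def T (m : ℕ) (lam : ℂ) : ScalFunctional m := fun φ =>
  (sphereArea m : ℂ) * finitePart (lam + m - 1) (sphMean φ)

/-- `U_λ = Fp r^λ ω`, with `ω = x / |x|`. -/
def U (m : ℕ) (lam : ℂ) : CliffFunctional m := fun φ =>
  ∑ j : Fin m, ((sphereArea m : ℂ) * finitePart (lam + m - 1) (sphMeanVec j φ)) • e j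

open Classical in
/-- The normalized distributions `T*_λ`; the exceptional values are `λ = -m-2l`, where
`T*_λ` is a multiple of `(-Δ)^l δ`. -/
def Tstar (m : ℕ) (lam : ℂ) : ScalFunctional m := fun φ =>
  if h : ∃ l : ℕ, lam = -(m : ℂ) - 2 * l then
    (Real.pi : ℂ) ^ ((m : ℂ) / 2 - h.choose) /
        (2 ^ (2 * h.choose) * Complex.Gamma ((m : ℂ) / 2 + h.choose)) *
      ((fun χ : 𝓢(Euc m, ℂ) => -Laplacian.laplacian χ)^[h.choose] φ) 0
  else
    (Real.pi : ℂ) ^ ((lam + m) / 2) / Complex.Gamma ((lam + m) / 2) * T m lam φ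

open Classical in
/-- The normalized distributions `U*_λ`; the exceptional values are `λ = -m-2l-1`, where
`U*_λ` is a multiple of `∂^{2l+1} δ`, with `∂` the Dirac operator. -/
def Ustar (m : ℕ) (lam : ℂ) : CliffFunctional m := fun φ =>
  if h : ∃ l : ℕ, lam = -(m : ℂ) - 2 * l - 1 then
    (-((Real.pi : ℂ) ^ ((m : ℂ) / 2 - h.choose) /
        (2 ^ (2 * h.choose + 1) * Complex.Gamma ((m : ℂ) / 2 + h.choose + 1)))) •
      (dirac^[2 * h.choose + 1] (delta m)) φ
  else
    ((Real.pi : ℂ) ^ ((lam + m + 1) / 2) / Complex.Gamma ((lam + m + 1) / 2)) • U m lam φ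

/-! ### The kernels `∂^μ H` and the operators `^μ𝓗` -/

/-- The coefficient of `T*_{-m-μ}` in `∂^μ H`. It is `0` when `μ` is an even integer (also when the
Gamma function has a pole at `(m + μ) / 2`), since then `1 - e^{iπμ} = 0`. -/
def coeffT (m : ℕ) (μ : ℂ) : ℂ :=
  (1 - Complex.exp (Complex.I * Real.pi * μ)) / 2 *
    (2 ^ μ * Complex.Gamma ((m + μ) / 2) / (Real.pi : ℂ) ^ ((m - μ) / 2))

/-- The coefficient of `-U*_{-m-μ}` in `∂^μ H`. It is `0` when `μ` is an odd integer (also when the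
Gamma function has a pole at `(m + μ + 1) / 2`), since then `1 + e^{iπμ} = 0`. -/
def coeffU (m : ℕ) (μ : ℂ) : ℂ :=
  (1 + Complex.exp (Complex.I * Real.pi * μ)) / 2 *
    (2 ^ μ * Complex.Gamma ((m + μ + 1) / 2) / (Real.pi : ℂ) ^ ((m - μ + 1) / 2))

/-- The convolution kernel `∂^μ H`. -/
def diracPowH (m : ℕ) (μ : ℂ) : CliffFunctional m := fun φ =>
  algebraMap ℂ (Cliff m) (coeffT m μ * Tstar m (-m - μ) φ) - coeffU m μ • Ustar m (-m - μ) φ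

/-- The convolution operator `^μ𝓗`, as a relation: `HilbertPow m μ f g` says that
`^μ𝓗[f] = ∂^μ H ∗ f` exists and is equal to `g`. -/
def HilbertPow (m : ℕ) (μ : ℂ) (f g : CliffFunctional m) : Prop :=
  IsConvolution (diracPowH m μ) f g

/-- `f` is a fundamental solution of the operator `^μ𝓗`, that is, `^μ𝓗[f] = δ`. -/
def IsFundamentalSolution (m : ℕ) (μ : ℂ) (f : CliffFunctional m) : Prop :=
  HilbertPow m μ f (delta m)

/-- The distribution `F_μ` (equal to `∂^{-μ} H`), by its explicit formula. -/
def F (m : ℕ) (μ : ℂ) : CliffFunctional m := fun φ =>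
  algebraMap ℂ (Cliff m)
      ((1 - Complex.exp (-(Complex.I * Real.pi * μ))) / 2 *
        (2 ^ (-μ) * Complex.Gamma ((m - μ) / 2) / (Real.pi : ℂ) ^ ((m + μ) / 2)) *
        Tstar m (-m + μ) φ)
    - ((1 + Complex.exp (-(Complex.I * Real.pi * μ))) / 2 *
        (2 ^ (-μ) * Complex.Gamma ((m - μ + 1) / 2) / (Real.pi : ℂ) ^ ((m + μ + 1) / 2))) •
        Ustar m (-m + μ) φ

end HilbertDirac

end

open scoped SchwartzMap TensorProduct LineDeriv

noncomputable section

namespace HilbertDirac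

open MeasureTheory Set Filter Topology FourierTransform

variable {m : ℕ}

/-! The statement is a multiplication of Fourier symbols. With $\chi(\xi)=i\,\xi/|\xi|$, which
squares to $1$ because $\xi^2=-|\xi|^2$ in the Clifford algebra, the symbol of the kernel is
$(2\pi|\xi|)^\mu\left(\frac{1-e^{i\pi\mu}}2+\frac{1+e^{i\pi\mu}}2\chi\right)=(2\pi|\xi|)^\mu(P_+-e^{i\pi\mu}P_-)$,
where $P_\pm=\frac{1\pm\chi}2$ are complementary idempotents. The symbols for $\mu$ and $-\mu$ are
therefore inverse to each other (`symbol_mul_symbol_neg`).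

The work lies in justifying the multiplication for finite-part kernels. The kernel is split into
components indexed by `Option (Fin m)`, the scalar one and the $m$ vector ones; `reg i z φ y` is the
regularization by `φ` of the component with symbol `symb i z`. The poles in `z` of the finite part
come from Taylor coefficients of spherical means, and parity leaves only those at `deg i + 2 * l`;
away from these and from the poles of the Gamma factor, `reg` is holomorphic in `z`. It decays like
$(1+|y|)^{-(m+\mathrm{Re}\,z-\varepsilon)}$, locally uniformly in `z` (`exists_norm_reg_le`). In the
product of the factors for `z` and `-z` the real parts cancel, leaving the exponent
$-(2m-2\varepsilon)$. Since $m\ge1$ this is integrable, whatever `z` is.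

For $-1<\mathrm{Re}\,z<0$ the Fourier formula for `reg` follows by taking the Mellin transform in
$t$ of the Fourier identity for $Y(x)e^{-\pi t|x|^2}$, with $Y=1$ or $x_j$
(`reg_eq_integral_of_neg`). It is continued analytically through the upper half plane
(`reg_eq_integral`). For $0<\mathrm{Re}\,z<1$ the first factor is integrable and Fourier inversion
applies, so the convolution equals the `z`-independent integral `pairInt`
(`integral_pair_of_strip`). Both sides being holomorphic in `z` off a set of integers, the identity
theorem extends this to all admissible exponents (`integral_pair`).

At the remaining exponents the coefficient of the offending component vanishes, except at the poles
of the Gamma factor for odd `m`, which the hypothesis excludes (`mem_dom_of_symbCoeff_ne_zero`). In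
particular the exceptional delta-type branches of `Tstar` and `Ustar` contribute nothing. -/

/-- The parity of the component with index `i`: `0` for the scalar one, `1` for the vector ones. -/
def deg (i : Option (Fin m)) : ℕ := i.elim 0 (fun _ => 1)

/-! ### Weighted spherical means and their parity. -/

/-- The spherical harmonic `1` or `x_j`. -/
def wt (i : Option (Fin m)) (x : Euc m) : ℂ := i.elim 1 (fun j => ((x j : ℝ) : ℂ))

theorem wt_smul (i : Option (Fin m)) (r : ℝ) (x : Euc m) :
    wt i (r • x) = (r : ℂ) ^ deg i * wt i x := by
  cases i <;> simp [wt, deg]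

theorem wt_neg (i : Option (Fin m)) (x : Euc m) : wt i (-x) = (-1) ^ deg i * wt i x := by
  cases i <;> simp [wt, deg]

theorem norm_wt_le (i : Option (Fin m)) (x : Euc m) : ‖wt i x‖ ≤ ‖x‖ ^ deg i := by
  cases i with
  | none => simp [wt, deg]
  | some j =>
    simp only [wt, deg, Option.elim, pow_one, Complex.norm_real]
    exact PiLp.norm_apply_le x j

@[fun_prop]
theorem continuous_wt (i : Option (Fin m)) : Continuous (wt i) := by
  cases i with
  | none => exact continuous_const
  | some j =>
    change Continuous fun x : Euc m => ((x j : ℝ) : ℂ)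
    fun_prop

theorem norm_wt_sphere_le (i : Option (Fin m)) (w : Metric.sphere (0 : Euc m) 1) :
    ‖wt i (w : Euc m)‖ ≤ 1 := by
  simpa using norm_wt_le i (w : Euc m)

/-- The weighted mean `∫ Y(w) D^k φ(y - r w)(-w, …, -w) dS(w)`. -/
def dmean (i : Option (Fin m)) (φ : 𝓢(Euc m, ℂ)) (k : ℕ) (y : Euc m) (r : ℝ) : ℂ :=
  ∫ w, wt i (w : Euc m) *
    iteratedFDeriv ℝ k φ (y - r • (w : Euc m)) (fun _ => -(w : Euc m)) ∂(sphereMeasure m)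

/-- The weighted spherical mean `∫ Y(w) φ(y - r w) dS(w)`. -/
def mean (i : Option (Fin m)) (φ : 𝓢(Euc m, ℂ)) (y : Euc m) (r : ℝ) : ℂ :=
  ∫ w, wt i (w : Euc m) * φ (y - r • (w : Euc m)) ∂(sphereMeasure m)

theorem dmean_zero (i : Option (Fin m)) (φ : 𝓢(Euc m, ℂ)) (y : Euc m) (r : ℝ) :
    dmean i φ 0 y r = mean i φ y r := by
  simp [dmean, mean]

theorem continuous_iteratedFDeriv_apply (φ : 𝓢(Euc m, ℂ)) (k : ℕ) :
    Continuous fun p : Euc m × Euc m => iteratedFDeriv ℝ k φ p.1 (fun _ => p.2) := by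
  have h1 : Continuous (iteratedFDeriv ℝ k φ) :=
    (φ.smooth (k : ℕ∞)).continuous_iteratedFDeriv le_rfl
  have h2 : Continuous fun q : (Euc m [×k]→L[ℝ] ℂ) × (Fin k → Euc m) => q.1 q.2 := by fun_prop
  exact h2.comp ((h1.comp continuous_fst).prodMk (continuous_pi fun _ => continuous_snd))

theorem norm_iteratedFDeriv_apply_le (φ : 𝓢(Euc m, ℂ)) (k : ℕ) (x : Euc m)
    (w : Metric.sphere (0 : Euc m) 1) :
    ‖iteratedFDeriv ℝ k φ x (fun _ => -(w : Euc m))‖ ≤ ‖iteratedFDeriv ℝ k φ x‖ := by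
  refine (ContinuousMultilinearMap.le_opNorm _ _).trans ?_
  simp

theorem norm_integrand_le (i : Option (Fin m)) (φ : 𝓢(Euc m, ℂ)) (k : ℕ) (x : Euc m)
    (w : Metric.sphere (0 : Euc m) 1) :
    ‖wt i (w : Euc m) * iteratedFDeriv ℝ k φ x (fun _ => -(w : Euc m))‖
      ≤ ‖iteratedFDeriv ℝ k φ x‖ := by
  rw [norm_mul]
  have h1 := norm_wt_sphere_le i w
  have h2 := norm_iteratedFDeriv_apply_le φ k x w
  nlinarith [norm_nonneg (wt i (w : Euc m)),
    norm_nonneg (iteratedFDeriv ℝ k φ x (fun _ => -(w : Euc m)))]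

theorem norm_iteratedFDeriv_le (φ : 𝓢(Euc m, ℂ)) (k : ℕ) (x : Euc m) :
    ‖iteratedFDeriv ℝ k φ x‖ ≤ SchwartzMap.seminorm ℝ 0 k φ := by
  simpa using SchwartzMap.le_seminorm ℝ 0 k φ x

theorem continuous_integrand (i : Option (Fin m)) (φ : 𝓢(Euc m, ℂ)) (k : ℕ) :
    Continuous fun q : (Euc m × ℝ) × Metric.sphere (0 : Euc m) 1 =>
      wt i (q.2 : Euc m) *
        iteratedFDeriv ℝ k φ (q.1.1 - q.1.2 • (q.2 : Euc m)) (fun _ => -(q.2 : Euc m)) := by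
  have h2 : Continuous fun q : (Euc m × ℝ) × Metric.sphere (0 : Euc m) 1 =>
      (q.1.1 - q.1.2 • (q.2 : Euc m), -(q.2 : Euc m)) := by fun_prop
  have h1 := (continuous_iteratedFDeriv_apply φ k).comp h2
  have h3 : Continuous fun q : (Euc m × ℝ) × Metric.sphere (0 : Euc m) 1 =>
      wt i (q.2 : Euc m) := by fun_prop
  exact h3.mul h1

theorem continuous_dmean (i : Option (Fin m)) (φ : 𝓢(Euc m, ℂ)) (k : ℕ) :
    Continuous fun q : Euc m × ℝ => dmean i φ k q.1 q.2 := by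
  have h := continuous_integrand i φ k
  refine MeasureTheory.continuous_of_dominated (bound := fun _ => SchwartzMap.seminorm ℝ 0 k φ)
    (fun q => ?_) (fun q => ?_) (integrable_const _) ?_
  · exact (h.comp (Continuous.prodMk_right q)).aestronglyMeasurable
  · exact Eventually.of_forall fun w =>
      (norm_integrand_le i φ k _ w).trans (norm_iteratedFDeriv_le φ k _)
  · exact Eventually.of_forall fun w => h.comp (Continuous.prodMk_left w)

theorem hasDerivAt_iteratedFDeriv_line (φ : 𝓢(Euc m, ℂ)) (k : ℕ) (y w : Euc m) (r : ℝ) :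
    HasDerivAt (fun r : ℝ => iteratedFDeriv ℝ k φ (y - r • w) (fun _ => -w))
      (iteratedFDeriv ℝ (k + 1) φ (y - r • w) (fun _ => -w)) r := by
  have h1 : DifferentiableAt ℝ (iteratedFDeriv ℝ k φ) (y - r • w) :=
    ((φ.smooth (k + 1 : ℕ)).differentiable_iteratedFDeriv
      (by exact_mod_cast Nat.lt_succ_self k)) _
  have h2 : HasDerivAt (fun r : ℝ => y - r • w) (-w) r := by
    simpa using ((hasDerivAt_id r).smul_const w).const_sub y
  have h3 := h1.hasFDerivAt.comp_hasDerivAt r h2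
  have h4 := (ContinuousMultilinearMap.apply ℝ (fun _ : Fin k => Euc m) ℂ
    (fun _ => -w)).hasFDerivAt.comp_hasDerivAt r h3
  exact h4

/-- Differentiation under the integral: the sphere has finite measure and a Schwartz seminorm
dominates the integrand. Each derivative in `r` of `φ (y - r w)` feeds one more argument `-w` to the
Fréchet derivative. -/
theorem hasDerivAt_dmean (i : Option (Fin m)) (φ : 𝓢(Euc m, ℂ)) (k : ℕ) (y : Euc m) (r : ℝ) :
    HasDerivAt (dmean i φ k y) (dmean i φ (k + 1) y r) r := by
  have hc : ∀ k r, Continuous fun w : Metric.sphere (0 : Euc m) 1 => wt i (w : Euc m) *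
      iteratedFDeriv ℝ k φ (y - r • (w : Euc m)) (fun _ => -(w : Euc m)) := fun k r =>
    (continuous_integrand i φ k).comp (Continuous.prodMk_right (y, r))
  refine (hasDerivAt_integral_of_dominated_loc_of_deriv_le (s := univ) (μ := sphereMeasure m)
    (F := fun r w => wt i (w : Euc m) *
      iteratedFDeriv ℝ k φ (y - r • (w : Euc m)) (fun _ => -(w : Euc m)))
    (F' := fun r w => wt i (w : Euc m) *
      iteratedFDeriv ℝ (k + 1) φ (y - r • (w : Euc m)) (fun _ => -(w : Euc m)))
    (bound := fun _ => SchwartzMap.seminorm ℝ 0 (k + 1) φ) univ_mem ?_ ?_ ?_ ?_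
    (integrable_const (μ := sphereMeasure m) _) ?_).2
  · exact Eventually.of_forall fun r => (hc k r).aestronglyMeasurable
  · exact (hc k r).integrable_of_hasCompactSupport (HasCompactSupport.of_compactSpace _)
  · exact (hc (k + 1) r).aestronglyMeasurable
  · exact Eventually.of_forall fun w r _ =>
      (norm_integrand_le i φ (k + 1) _ w).trans (norm_iteratedFDeriv_le φ (k + 1) _)
  · exact Eventually.of_forall fun w r _ =>
      (hasDerivAt_iteratedFDeriv_line φ k y w r).const_mul _

theorem iteratedDeriv_mean (i : Option (Fin m)) (φ : 𝓢(Euc m, ℂ)) (k : ℕ) (y : Euc m) :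
    iteratedDeriv k (mean i φ y) = dmean i φ k y := by
  induction k with
  | zero => ext r; simp [dmean_zero]
  | succ k ih =>
    rw [iteratedDeriv_succ, ih]
    ext r
    exact (hasDerivAt_dmean i φ k y r).deriv

theorem contDiff_mean (i : Option (Fin m)) (φ : 𝓢(Euc m, ℂ)) (y : Euc m) (n : ℕ) :
    ContDiff ℝ n (mean i φ y) := by
  refine contDiff_of_differentiable_iteratedDeriv fun k _ => ?_
  rw [iteratedDeriv_mean]
  exact fun r => (hasDerivAt_dmean i φ k y r).differentiableAt

open scoped Pointwise in
-- The surface measure of `s` is, up to a constant, the volume of the cone `Ioo 0 1 • s`, and volume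
-- is invariant under negation.
theorem measurePreserving_neg_sphere :
    MeasurePreserving (fun w : Metric.sphere (0 : Euc m) 1 => -w) (sphereMeasure m)
      (sphereMeasure m) := by
  refine ⟨by fun_prop, ?_⟩
  ext s hs
  have h : Ioo (0 : ℝ) 1 • (Subtype.val '' ((fun w : Metric.sphere (0 : Euc m) 1 => -w) ⁻¹' s)) =
      -(Ioo (0 : ℝ) 1 • (Subtype.val '' s) : Set (Euc m)) := by
    ext x
    simp only [Set.mem_smul, Set.mem_image, Set.mem_preimage, Set.mem_neg]
    constructor
    · rintro ⟨r, hr, _, ⟨w, hw, rfl⟩, rfl⟩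
      exact ⟨r, hr, _, ⟨-w, hw, rfl⟩, by simp⟩
    · rintro ⟨r, hr, _, ⟨w, hw, rfl⟩, h⟩
      refine ⟨r, hr, _, ⟨-w, by simpa using hw, rfl⟩, ?_⟩
      simp [h]
  rw [Measure.map_apply (by fun_prop) hs, Measure.toSphere_apply' _ hs,
    Measure.toSphere_apply' _ (hs.preimage (by fun_prop)), h, Measure.measure_neg]

theorem mean_neg (i : Option (Fin m)) (φ : 𝓢(Euc m, ℂ)) (y : Euc m) (r : ℝ) :
    mean i φ y (-r) = (-1) ^ deg i * mean i φ y r := by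
  have h := (measurePreserving_neg_sphere (m := m)).integral_comp
    (Homeomorph.neg _).measurableEmbedding
    (fun w => wt i (w : Euc m) * φ (y - (-r) • (w : Euc m)))
  rw [mean, ← h, mean, ← integral_const_mul]
  congr 1
  ext w
  simp [wt_neg, mul_assoc]

/-- The mean is an even function of `r` for the scalar component and an odd one for a vector
component, so half of its Taylor coefficients vanish. This removes half of the possible poles of the
finite part. -/
theorem dmean_at_zero_eq_zero (i : Option (Fin m)) (φ : 𝓢(Euc m, ℂ)) (y : Euc m) (k : ℕ)
    (h : Odd (k + deg i)) : dmean i φ k y 0 = 0 := by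
  have h1 : (fun r => mean i φ y (-r)) = fun r => (-1) ^ deg i * mean i φ y r :=
    funext (mean_neg i φ y)
  have h2 := iteratedDeriv_comp_neg k (mean i φ y) 0
  rw [h1, iteratedDeriv_const_mul_field, iteratedDeriv_mean, neg_zero] at h2
  have h3 : ((-1 : ℂ) ^ deg i) * ((-1) ^ deg i) = 1 := by
    rw [← pow_add, ← two_mul, pow_mul]; simp
  have h4 : (-1 : ℂ) ^ k * (-1) ^ deg i = -1 := by rw [← pow_add]; exact h.neg_one_pow
  have h5 : dmean i φ k y 0 = - dmean i φ k y 0 := by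
    calc dmean i φ k y 0 = (-1) ^ deg i * ((-1) ^ deg i * dmean i φ k y 0) := by
          rw [← mul_assoc, h3, one_mul]
      _ = ((-1 : ℂ) ^ k * (-1) ^ deg i) * dmean i φ k y 0 := by
          rw [h2, Complex.real_smul]; push_cast; ring
      _ = _ := by rw [h4]; ring
  exact self_eq_neg.mp h5

/-! ### The finite part as a Mellin transform. -/

/-- The Taylor polynomial of degree `N - 1` of `f` at `0`. -/
def taylorPoly (f : ℝ → ℂ) (N : ℕ) (r : ℝ) : ℂ :=
  ∑ k ∈ Finset.range N, iteratedDeriv k f 0 / (Nat.factorial k : ℂ) * (r : ℂ) ^ k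

/-- `f` minus its Taylor polynomial of degree `N - 1` on `(0, 1]`, and `f` elsewhere. -/
def taylorRem (f : ℝ → ℂ) (N : ℕ) (r : ℝ) : ℂ :=
  f r - (Ioc (0 : ℝ) 1).indicator (taylorPoly f N) r

theorem continuous_taylorPoly (f : ℝ → ℂ) (N : ℕ) : Continuous (taylorPoly f N) := by
  unfold taylorPoly
  fun_prop

theorem norm_sub_taylorPoly_le {f : ℝ → ℂ} {N : ℕ} (hf : ContDiff ℝ N f) {C : ℝ}
    (hC : ∀ r ∈ Icc (0 : ℝ) 1, ‖iteratedDeriv N f r‖ ≤ C) {r : ℝ} (hr : r ∈ Icc (0 : ℝ) 1) :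
    ‖f r - taylorPoly f N r‖ ≤ C * r ^ N := by
  cases N with
  | zero => simpa [taylorPoly] using hC r hr
  | succ n =>
    have hu : UniqueDiffOn ℝ (Icc (0 : ℝ) 1) := uniqueDiffOn_Icc one_pos
    have h1 := taylor_mean_remainder_bound (n := n) (C := C) zero_le_one
      (by exact_mod_cast hf.contDiffOn) hr (fun y hy => by
        rw [iteratedDerivWithin_eq_iteratedDeriv hu hf.contDiffAt hy]
        exact hC y hy)
    have h2 : taylorWithinEval f n (Icc 0 1) 0 r = taylorPoly f (n + 1) r := by
      rw [taylor_within_apply, taylorPoly]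
      refine Finset.sum_congr rfl fun k hk => ?_
      rw [iteratedDerivWithin_eq_iteratedDeriv hu
        ((hf.of_le (by exact_mod_cast (Finset.mem_range.mp hk).le)).contDiffAt)
        (by simp), Complex.real_smul]
      push_cast
      rw [sub_zero]
      field_simp
    rw [h2, sub_zero] at h1
    refine h1.trans (div_le_self ?_ (by exact_mod_cast Nat.one_le_iff_ne_zero.mpr n.factorial_ne_zero))
    exact mul_nonneg ((norm_nonneg _).trans (hC r hr)) (pow_nonneg hr.1 _)

/-- One more subtracted term is a monomial cut off to `(0, 1]`, whose Mellin transform is explicit;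
this drives the induction in `finitePart_eq`. -/
theorem taylorRem_succ (f : ℝ → ℂ) (N : ℕ) :
    taylorRem f N = fun r => taylorRem f (N + 1) r + (iteratedDeriv N f 0 / (Nat.factorial N : ℂ)) •
      (Ioc (0 : ℝ) 1).indicator (fun r : ℝ => (r : ℂ) ^ (N : ℂ)) r := by
  ext r
  by_cases hr : r ∈ Ioc (0 : ℝ) 1
  · simp [taylorRem, hr, taylorPoly, Finset.sum_range_succ]
    ring
  · simp [taylorRem, hr]

theorem locallyIntegrableOn_taylorRem {f : ℝ → ℂ} (hf : ∀ n : ℕ, ContDiff ℝ n f)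
    (N : ℕ) :
    LocallyIntegrableOn (taylorRem f N) (Ioi 0) := by
  refine ((hf 0).continuous.locallyIntegrable.sub ?_).locallyIntegrableOn _
  refine (Integrable.locallyIntegrable ?_)
  rw [integrable_indicator_iff measurableSet_Ioc]
  exact ((continuous_taylorPoly f N).integrableOn_Icc).mono_set Ioc_subset_Icc_self

theorem taylorRem_isBigO_atTop {f : ℝ → ℂ} (hd : ∀ a : ℝ, f =O[atTop] (fun r => r ^ (-a)))
    (N : ℕ) (a : ℝ) :
    taylorRem f N =O[atTop] (fun r => r ^ (-a)) := by
  refine (hd a).congr' ?_ EventuallyEq.rfl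
  filter_upwards [eventually_gt_atTop 1] with r hr
  simp [taylorRem, hr]

theorem taylorRem_isBigO_zero {f : ℝ → ℂ} (hf : ∀ n : ℕ, ContDiff ℝ n f)
    (N : ℕ) :
    taylorRem f N =O[𝓝[>] 0] (fun r => r ^ (-(-(N : ℝ)))) := by
  obtain ⟨C, hC⟩ := isCompact_Icc.exists_bound_of_continuousOn (s := Icc (0 : ℝ) 1)
    ((hf N).continuous_iteratedDeriv N le_rfl).continuousOn
  refine Asymptotics.IsBigO.of_bound C ?_
  filter_upwards [Ioc_mem_nhdsGT (zero_lt_one (α := ℝ))] with r hr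
  have := norm_sub_taylorPoly_le (hf N) hC (Ioc_subset_Icc_self hr)
  simpa [taylorRem, hr, abs_of_pos hr.1] using this

/-- As the polynomial is subtracted only on `(0, 1]`, the remainder is `O(r^N)` at `0` and keeps the
rapid decay of `f` at infinity. A single Mellin transform thus covers the whole half plane `Re z <
N`. -/
theorem mellinConvergent_taylorRem {f : ℝ → ℂ} (hf : ∀ n : ℕ, ContDiff ℝ n f) (hd : ∀ a : ℝ, f =O[atTop] (fun r => r ^ (-a)))
    {N : ℕ} {z : ℂ} (hz : z.re < N) :
    MellinConvergent (taylorRem f N) (-z) :=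
  mellinConvergent_of_isBigO_rpow (a := -z.re + 1) (locallyIntegrableOn_taylorRem hf N)
    (taylorRem_isBigO_atTop hd N _) (by simp) (taylorRem_isBigO_zero hf N) (by simpa using hz)

theorem differentiableAt_mellin_taylorRem {f : ℝ → ℂ} (hf : ∀ n : ℕ, ContDiff ℝ n f) (hd : ∀ a : ℝ, f =O[atTop] (fun r => r ^ (-a)))
    {N : ℕ} {z : ℂ} (hz : z.re < N) :
    DifferentiableAt ℂ (fun z => mellin (taylorRem f N) (-z)) z := by
  have := mellin_differentiableAt_of_isBigO_rpow (a := -z.re + 1) (s := -z)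
    (locallyIntegrableOn_taylorRem hf N)
    (taylorRem_isBigO_atTop hd N _) (by simp) (taylorRem_isBigO_zero hf N) (by simpa using hz)
  exact this.comp z differentiable_neg.differentiableAt

theorem finitePart_eq_floor {f : ℝ → ℂ} (hf : ∀ n : ℕ, ContDiff ℝ n f) (hd : ∀ a : ℝ, f =O[atTop] (fun r => r ^ (-a)))
    (z : ℂ) :
    finitePart (-z - 1) f = mellin (taylorRem f ⌊z.re + 1⌋₊) (-z) +
      ∑ k ∈ Finset.range ⌊z.re + 1⌋₊,
        iteratedDeriv k f 0 / (Nat.factorial k : ℂ) / (k - z) := by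
  have h0 : -(-z - 1).re = z.re + 1 := by simp; ring
  rw [finitePart, h0]
  have hconv : MellinConvergent (taylorRem f ⌊z.re + 1⌋₊) (-z) :=
    mellinConvergent_taylorRem hf hd (by have := Nat.lt_floor_add_one (z.re + 1); linarith)
  rw [MellinConvergent, ← Ioc_union_Ioi_eq_Ioi (zero_le_one (α := ℝ))] at hconv
  rw [mellin, ← Ioc_union_Ioi_eq_Ioi (zero_le_one (α := ℝ)),
    setIntegral_union Ioc_disjoint_Ioi_same measurableSet_Ioi
      (hconv.mono_set subset_union_left) (hconv.mono_set subset_union_right)]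
  congr 1
  · congr 1
    · refine setIntegral_congr_fun measurableSet_Ioc fun r hr => ?_
      simp [taylorRem, hr, taylorPoly]
    · refine setIntegral_congr_fun measurableSet_Ioi fun r hr => ?_
      have : ¬ r ≤ 1 := not_le.mpr hr
      simp [taylorRem, this]
  · refine Finset.sum_congr rfl fun k _ => ?_
    congr 1
    ring

/-- The finite part may be computed by subtracting a Taylor polynomial of any sufficiently large
degree. -/
theorem finitePart_eq {f : ℝ → ℂ} (hf : ∀ n : ℕ, ContDiff ℝ n f) (hd : ∀ a : ℝ, f =O[atTop] (fun r => r ^ (-a)))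
    {N : ℕ} {z : ℂ} (hz : z.re < N) :
    finitePart (-z - 1) f = mellin (taylorRem f N) (-z) +
      ∑ k ∈ Finset.range N, iteratedDeriv k f 0 / (Nat.factorial k : ℂ) / (k - z) := by
  have hn : ⌊z.re + 1⌋₊ ≤ N := by
    rw [← Nat.lt_succ_iff, Nat.floor_lt' (Nat.succ_ne_zero N)]
    push_cast
    linarith
  -- The strict bound is needed at each intermediate `n`, not at `N`; there it is recovered from
  -- `hn`.
  clear hz
  induction N, hn using Nat.le_induction with
  | base => exact finitePart_eq_floor hf hd z
  | succ n hn ih =>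
    have hz : z.re < n := by
      have h1 := Nat.lt_floor_add_one (z.re + 1)
      have h2 : ((⌊z.re + 1⌋₊ : ℕ) : ℝ) ≤ n := by exact_mod_cast hn
      linarith
    have h1 := hasMellin_cpow_Ioc (n : ℂ) (s := -z) (by simpa using hz)
    have h2 := mellinConvergent_taylorRem hf hd (N := n + 1) (z := z)
      (hz.trans (by push_cast; linarith))
    have h3 := (hasMellin_add h2 (h1.1.const_smul (iteratedDeriv n f 0 / (Nat.factorial n : ℂ)))).2
    rw [ih, taylorRem_succ, h3, mellin_const_smul, h1.2, Finset.sum_range_succ, smul_eq_mul]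
    have h4 : -z + (n : ℂ) = n - z := by ring
    rw [h4]
    ring

/-! ### Polar coordinates and decay estimates. -/

/-- Integration in spherical coordinates. -/
theorem integral_polar {F : Type*} [NormedAddCommGroup F] [NormedSpace ℝ F]
    {g : Euc m → F} (hm : 1 ≤ m) (hg : Integrable g) :
    IntegrableOn (fun r : ℝ => r ^ (m - 1) • ∫ w, g (r • (w : Euc m)) ∂(sphereMeasure m)) (Ioi 0) ∧
      ∫ x, g x =
        ∫ r in Ioi (0 : ℝ), r ^ (m - 1) • ∫ w, g (r • (w : Euc m)) ∂(sphereMeasure m) := by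
  have : Nonempty (Fin m) := ⟨⟨0, hm⟩⟩
  have hfin : Module.finrank ℝ (Euc m) = m := by simp
  have hmp := (volume : Measure (Euc m)).measurePreserving_homeomorphUnitSphereProd
  rw [hfin] at hmp
  have hemb := (homeomorphUnitSphereProd (Euc m)).measurableEmbedding
  set G : Metric.sphere (0 : Euc m) 1 × Ioi (0 : ℝ) → F :=
    fun q => g ((q.2 : ℝ) • (q.1 : Euc m)) with hG
  -- The polar homeomorphism only sees the complement of the origin, which has full measure.
  have hGx : ∀ x : ({0}ᶜ : Set (Euc m)), G (homeomorphUnitSphereProd (Euc m) x) = g x := by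
    intro x
    have : ‖(x : Euc m)‖ ≠ 0 := norm_ne_zero_iff.mpr x.2
    simp [hG, smul_smul, this]
  have hmeas : MeasurableSet ({0}ᶜ : Set (Euc m)) := (measurableSet_singleton _).compl
  have hint : Integrable G ((sphereMeasure m).prod (Measure.volumeIoiPow (m - 1))) := by
    rw [← hmp.integrable_comp_emb hemb]
    have h1 : IntegrableOn g ({0}ᶜ : Set (Euc m)) := hg.integrableOn
    rw [integrableOn_iff_comap_subtypeVal hmeas] at h1
    exact h1.congr (Eventually.of_forall fun x => (hGx x).symm)
  have hval : ∫ x, g x = ∫ q, G q ∂((sphereMeasure m).prod (Measure.volumeIoiPow (m - 1))) := by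
    rw [← hmp.integral_comp hemb]
    simp_rw [hGx]
    rw [integral_subtype_comap hmeas g, restrict_compl_singleton]
  have h2 := hint.integral_prod_right
  have hcoe : ∀ r : Ioi (0 : ℝ), ((Real.toNNReal ((r : ℝ) ^ (m - 1)) : NNReal) : ℝ) =
      (r : ℝ) ^ (m - 1) := fun r => Real.coe_toNNReal _ (pow_nonneg r.2.out.le _)
  have hmr : Measurable fun r : Ioi (0 : ℝ) => Real.toNNReal ((r : ℝ) ^ (m - 1)) :=
    (measurable_subtype_coe.pow_const _).real_toNNReal
  constructor
  · rw [integrableOn_iff_comap_subtypeVal measurableSet_Ioi]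
    rw [Measure.volumeIoiPow] at h2
    have h3 := (integrable_withDensity_iff_integrable_smul hmr).mp h2
    refine h3.congr (Eventually.of_forall fun r => ?_)
    simp only [NNReal.smul_def, hcoe]
    rfl
  · rw [hval, integral_prod_symm _ hint]
    simp only [Measure.volumeIoiPow, ENNReal.ofReal]
    rw [integral_withDensity_eq_integral_smul hmr]
    simp only [NNReal.smul_def, hcoe]
    exact integral_subtype_comap measurableSet_Ioi
      fun r : ℝ => r ^ (m - 1) • ∫ w, g (r • (w : Euc m)) ∂(sphereMeasure m)

/-- A seminorm controlling `n` derivatives with the weight `(1 + ‖x‖)^K`. -/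
def snorm (K n : ℕ) (φ : 𝓢(Euc m, ℂ)) : ℝ :=
  2 ^ K * ((Finset.Iic (K, n)).sup fun q => SchwartzMap.seminorm ℂ q.1 q.2) φ

theorem snorm_nonneg (K n : ℕ) (φ : 𝓢(Euc m, ℂ)) : 0 ≤ snorm K n φ :=
  mul_nonneg (by positivity) (apply_nonneg _ _)

theorem norm_iteratedFDeriv_le_snorm {K n k : ℕ} (hk : k ≤ n) (φ : 𝓢(Euc m, ℂ)) (x : Euc m) :
    ‖iteratedFDeriv ℝ k φ x‖ ≤ snorm K n φ * (1 + ‖x‖) ^ (-(K : ℝ)) := by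
  have h := SchwartzMap.one_add_le_sup_seminorm_apply (𝕜 := ℂ) (m := (K, n)) le_rfl hk φ x
  rw [Real.rpow_neg (by positivity), Real.rpow_natCast, ← div_eq_mul_inv, le_div_iff₀ (by positivity),
    mul_comm]
  exact h

theorem norm_le_snorm {K n : ℕ} (φ : 𝓢(Euc m, ℂ)) (x : Euc m) :
    ‖φ x‖ ≤ snorm K n φ * (1 + ‖x‖) ^ (-(K : ℝ)) := by
  simpa using norm_iteratedFDeriv_le_snorm (K := K) (Nat.zero_le n) φ x

theorem one_add_norm_le_mul (x y : Euc m) : 1 + ‖x‖ ≤ (1 + ‖y‖) * (1 + ‖y - x‖) := by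
  have h := norm_sub_norm_le x y
  rw [norm_sub_rev] at h
  nlinarith [norm_nonneg y, norm_nonneg (y - x)]

/-- Peetre's inequality. -/
theorem rpow_one_add_norm_le (s : ℝ) (x y : Euc m) :
    (1 + ‖x‖) ^ s ≤ (1 + ‖y‖) ^ s * (1 + ‖y - x‖) ^ |s| := by
  rcases le_total 0 s with hs | hs
  · rw [abs_of_nonneg hs, ← Real.mul_rpow (by positivity) (by positivity)]
    exact Real.rpow_le_rpow (by positivity) (one_add_norm_le_mul x y) hs
  · have h := one_add_norm_le_mul y x
    rw [norm_sub_rev] at h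
    have h1 := Real.rpow_le_rpow (by positivity) h (neg_nonneg.mpr hs)
    rw [Real.mul_rpow (by positivity) (by positivity), Real.rpow_neg (by positivity),
      Real.rpow_neg (x := 1 + ‖x‖) (by positivity)] at h1
    rw [abs_of_nonpos hs]
    have hx : 0 < (1 + ‖x‖) ^ s := by positivity
    have hy : 0 < (1 + ‖y‖) ^ s := by positivity
    rw [inv_le_iff_one_le_mul₀ hy, mul_assoc, mul_comm _ (_ * _), ← div_eq_mul_inv, le_div_iff₀ hx,
      one_mul] at h1
    linarith

/-- For `r ≤ 1` the point `y - r w` stays within distance `1` of `y`, so `1 + ‖y‖ ≤ 2 (1 + ‖y - r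
w‖)` transfers the decay of `φ` to `y`. The part of the finite part near the origin is therefore
rapidly decreasing in `y`. -/
theorem norm_dmean_le (i : Option (Fin m)) {K n k : ℕ} (hk : k ≤ n) (φ : 𝓢(Euc m, ℂ)) (y : Euc m)
    {r : ℝ} (hr : r ∈ Icc (0 : ℝ) 1) :
    ‖dmean i φ k y r‖ ≤
      (sphereMeasure m).real univ * 2 ^ K * snorm K n φ * (1 + ‖y‖) ^ (-(K : ℝ)) := by
  have h : ∀ w : Metric.sphere (0 : Euc m) 1, ‖wt i (w : Euc m) *
      iteratedFDeriv ℝ k φ (y - r • (w : Euc m)) (fun _ => -(w : Euc m))‖ ≤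
      2 ^ K * snorm K n φ * (1 + ‖y‖) ^ (-(K : ℝ)) := by
    intro w
    refine (norm_integrand_le i φ k _ w).trans
      ((norm_iteratedFDeriv_le_snorm (K := K) hk φ _).trans ?_)
    have h1 := one_add_norm_le_mul y (y - r • (w : Euc m))
    have h2 : ‖y - r • (w : Euc m) - y‖ ≤ 1 := by
      simpa [norm_smul, abs_of_nonneg hr.1] using hr.2
    have h3 : 1 + ‖y‖ ≤ 2 * (1 + ‖y - r • (w : Euc m)‖) := by
      nlinarith [norm_nonneg (y - r • (w : Euc m))]
    have h4 : (1 + ‖y - r • (w : Euc m)‖) ^ (-(K : ℝ)) ≤ 2 ^ K * (1 + ‖y‖) ^ (-(K : ℝ)) := by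
      rw [Real.rpow_neg (by positivity), Real.rpow_neg (by positivity), Real.rpow_natCast,
        Real.rpow_natCast, ← div_eq_mul_inv, le_div_iff₀ (by positivity), inv_mul_le_iff₀
        (by positivity), mul_comm, ← mul_pow, ]
      exact pow_le_pow_left₀ (by positivity) h3 K
    calc _ ≤ snorm K n φ * (2 ^ K * (1 + ‖y‖) ^ (-(K : ℝ))) :=
          mul_le_mul_of_nonneg_left h4 (snorm_nonneg K n φ)
      _ = _ := by ring
  refine (norm_integral_le_of_norm_le_const (Eventually.of_forall h)).trans (le_of_eq ?_)
  ring

theorem norm_mean_le (i : Option (Fin m)) (K : ℕ) (φ : 𝓢(Euc m, ℂ)) (y : Euc m) {r : ℝ}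
    (hr : 0 ≤ r) :
    ‖mean i φ y r‖ ≤ (sphereMeasure m).real univ * snorm K 0 φ * (1 + ‖y‖) ^ (K : ℝ) *
      (1 + r) ^ (-(K : ℝ)) := by
  have h : ∀ w : Metric.sphere (0 : Euc m) 1, ‖wt i (w : Euc m) * φ (y - r • (w : Euc m))‖ ≤
      snorm K 0 φ * (1 + ‖y‖) ^ (K : ℝ) * (1 + r) ^ (-(K : ℝ)) := by
    intro w
    rw [norm_mul]
    have h0 := norm_wt_sphere_le i w
    have h1 := norm_le_snorm (K := K) (n := 0) φ (y - r • (w : Euc m))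
    have h2 := rpow_one_add_norm_le (K : ℝ) (r • (w : Euc m)) y
    rw [abs_of_nonneg (by positivity), norm_smul, norm_eq_of_mem_sphere w, mul_one,
      Real.norm_of_nonneg hr] at h2
    have h3 : (1 + ‖y - r • (w : Euc m)‖) ^ (-(K : ℝ)) ≤
        (1 + ‖y‖) ^ (K : ℝ) * (1 + r) ^ (-(K : ℝ)) := by
      rw [Real.rpow_neg (by positivity), Real.rpow_neg (by positivity), ← div_eq_mul_inv,
        le_div_iff₀ (by positivity), inv_mul_le_iff₀ (by positivity), mul_comm]
      linarith
    calc _ ≤ 1 * ‖φ (y - r • (w : Euc m))‖ := mul_le_mul_of_nonneg_right h0 (norm_nonneg _)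
      _ ≤ snorm K 0 φ * (1 + ‖y - r • (w : Euc m)‖) ^ (-(K : ℝ)) := by rwa [one_mul]
      _ ≤ _ := mul_le_mul_of_nonneg_left h3 (snorm_nonneg K 0 φ)
      _ = _ := by ring
  refine (norm_integral_le_of_norm_le_const (Eventually.of_forall h)).trans (le_of_eq ?_)
  ring

theorem mean_isBigO (i : Option (Fin m)) (φ : 𝓢(Euc m, ℂ)) (y : Euc m) (a : ℝ) :
    mean i φ y =O[atTop] (fun r => r ^ (-a)) := by
  obtain ⟨K, hK⟩ := exists_nat_ge a
  refine Asymptotics.IsBigO.of_bound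
    ((sphereMeasure m).real univ * snorm K 0 φ * (1 + ‖y‖) ^ (K : ℝ)) ?_
  filter_upwards [eventually_ge_atTop 1] with r hr
  have hr0 : 0 < r := by linarith
  refine (norm_mean_le i K φ y hr0.le).trans
    (mul_le_mul_of_nonneg_left ?_ (mul_nonneg (mul_nonneg (by positivity) (snorm_nonneg _ _ _))
      (by positivity)))
  rw [Real.norm_of_nonneg (by positivity)]
  calc (1 + r) ^ (-(K : ℝ)) ≤ r ^ (-(K : ℝ)) :=
        Real.rpow_le_rpow_of_nonpos hr0 (by linarith) (by simp)
    _ ≤ r ^ (-a) := Real.rpow_le_rpow_of_exponent_le hr (by linarith)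

/-- The right side does not depend on `z` in the strip `a ≤ Re z ≤ b`: on `(0, 1]` the worst
exponent is `b`, on `(1, ∞)` it is `a`. -/
theorem norm_mellin_taylorRem_le {f : ℝ → ℂ} (hf : ∀ n : ℕ, ContDiff ℝ n f)
    (hd : ∀ a : ℝ, f =O[atTop] (fun r => r ^ (-a))) {N : ℕ} {C a b : ℝ} {z : ℂ}
    (hC : ∀ r ∈ Icc (0 : ℝ) 1, ‖iteratedDeriv N f r‖ ≤ C)
    (ha : a ≤ z.re) (hb : z.re ≤ b) (hbN : b < N)
    (hint : IntegrableOn (fun r : ℝ => r ^ (-a - 1) * ‖f r‖) (Ioi 1)) :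
    ‖mellin (taylorRem f N) (-z)‖ ≤ C / (N - b) + ∫ r in Ioi (1 : ℝ), r ^ (-a - 1) * ‖f r‖ := by
  have hC0 : 0 ≤ C := (norm_nonneg _).trans (hC 0 (by simp))
  have hconv := mellinConvergent_taylorRem hf hd (hb.trans_lt hbN)
  rw [MellinConvergent, ← Ioc_union_Ioi_eq_Ioi (zero_le_one (α := ℝ))] at hconv
  rw [mellin, ← Ioc_union_Ioi_eq_Ioi (zero_le_one (α := ℝ)),
    setIntegral_union Ioc_disjoint_Ioi_same measurableSet_Ioi
      (hconv.mono_set subset_union_left) (hconv.mono_set subset_union_right)]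
  refine (norm_add_le _ _).trans (add_le_add ?_ ?_)
  · have h1 : IntervalIntegrable (fun r : ℝ => r ^ ((N : ℝ) - b - 1)) volume 0 1 :=
      intervalIntegral.intervalIntegrable_rpow' (by linarith)
    have h2 : ∫ r in Ioc (0 : ℝ) 1, C * r ^ ((N : ℝ) - b - 1) = C / (N - b) := by
      rw [integral_const_mul, ← intervalIntegral.integral_of_le zero_le_one,
        integral_rpow (Or.inl (by linarith)), sub_add_cancel, Real.one_rpow,
        Real.zero_rpow (by linarith), sub_zero, mul_one_div]
    rw [← h2]
    refine norm_integral_le_of_norm_le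
      (((intervalIntegrable_iff_integrableOn_Ioc_of_le zero_le_one).mp h1).const_mul C) ?_
    filter_upwards [ae_restrict_mem measurableSet_Ioc] with r hr
    have h3 := norm_sub_taylorPoly_le (hf N) hC (Ioc_subset_Icc_self hr)
    rw [norm_smul, Complex.norm_cpow_eq_rpow_re_of_pos hr.1]
    have h4 : taylorRem f N r = f r - taylorPoly f N r := by simp [taylorRem, hr]
    rw [h4]
    calc r ^ (-z - 1).re * ‖f r - taylorPoly f N r‖
        ≤ r ^ (-z - 1).re * (C * r ^ N) := by gcongr; exact Real.rpow_nonneg hr.1.le _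
      _ = C * r ^ ((-z - 1).re + N) := by
          rw [Real.rpow_add_natCast hr.1.ne']; ring
      _ ≤ C * r ^ ((N : ℝ) - b - 1) := by
          refine mul_le_mul_of_nonneg_left ?_ hC0
          refine Real.rpow_le_rpow_of_exponent_ge hr.1 hr.2 ?_
          simp only [Complex.sub_re, Complex.neg_re, Complex.one_re]
          linarith
  · refine norm_integral_le_of_norm_le hint ?_
    filter_upwards [ae_restrict_mem measurableSet_Ioi] with r hr
    have hr1 : 1 < r := hr
    rw [norm_smul, Complex.norm_cpow_eq_rpow_re_of_pos (by linarith)]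
    have h4 : taylorRem f N r = f r := by
      have : ¬ r ≤ 1 := not_le.mpr hr1
      simp [taylorRem, this]
    rw [h4]
    gcongr
    · exact hr1.le
    · simp only [Complex.sub_re, Complex.neg_re, Complex.one_re]
      linarith

theorem rpow_neg_le_two_rpow_mul (s : ℝ) {r : ℝ} (hr : 1 ≤ r) :
    r ^ (-s) ≤ 2 ^ |s| * (1 + r) ^ (-s) := by
  rcases le_total 0 s with hs | hs
  · rw [abs_of_nonneg hs, Real.rpow_neg (by positivity), Real.rpow_neg (by positivity),
      ← div_eq_mul_inv, le_div_iff₀ (by positivity), inv_mul_le_iff₀ (by positivity),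
      mul_comm, ← Real.mul_rpow (by positivity) (by positivity)]
    exact Real.rpow_le_rpow (by positivity) (by linarith) hs
  · have h1 : (1 : ℝ) ≤ 2 ^ |s| := Real.one_le_rpow (by norm_num) (abs_nonneg s)
    have h2 : r ^ (-s) ≤ (1 + r) ^ (-s) :=
      Real.rpow_le_rpow (by positivity) (by linarith) (by linarith)
    have h3 : 0 ≤ (1 + r) ^ (-s) := by positivity
    nlinarith

theorem integrable_one_add_norm_sub (y : Euc m) :
    Integrable (fun x : Euc m => (1 + ‖y - x‖) ^ (-((m : ℝ) + 1))) := by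
  have h : Integrable (fun x : Euc m => (1 + ‖x‖) ^ (-((m : ℝ) + 1))) :=
    integrable_one_add_norm (by simp)
  exact h.comp_sub_left y

/-- The part of the finite part away from the origin is `O((1 + ‖y‖)^(-m-a))`. -/
theorem exists_integral_far_le (hm : 1 ≤ m) (i : Option (Fin m)) (a : ℝ) :
    ∃ (C : ℝ) (K : ℕ), 0 ≤ C ∧ ∀ K' : ℕ, K ≤ K' → ∀ (φ : 𝓢(Euc m, ℂ)) (y : Euc m),
      IntegrableOn (fun r : ℝ => r ^ (-a - 1) * ‖mean i φ y r‖) (Ioi 1) ∧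
      ∫ r in Ioi (1 : ℝ), r ^ (-a - 1) * ‖mean i φ y r‖ ≤
        C * snorm K' 0 φ * (1 + ‖y‖) ^ (-(m + a)) := by
  set s : ℝ := m + a with hs
  -- The decay of `φ` pays `|s|` for Peetre's inequality and keeps `m + 1` for integrability over
  -- `ℝ^m`.
  obtain ⟨K, hK⟩ := exists_nat_ge (|s| + m + 1)
  refine ⟨2 ^ |s| * ∫ x : Euc m, (1 + ‖x‖) ^ (-((m : ℝ) + 1)), K, by positivity,
    fun K' hK' φ y => ?_⟩
  set D : ℝ := 2 ^ |s| * snorm K' 0 φ * (1 + ‖y‖) ^ (-s) with hD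
  have hD0 : 0 ≤ D := mul_nonneg (mul_nonneg (by positivity) (snorm_nonneg _ _ _)) (by positivity)
  have hg : Integrable (fun x : Euc m => D * (1 + ‖y - x‖) ^ (-((m : ℝ) + 1))) :=
    (integrable_one_add_norm_sub y).const_mul D
  obtain ⟨hp1, hp2⟩ := integral_polar hm hg
  -- Write `r^(-a-1) = r^(m-1) r^(-s)`. By Peetre, `r^(-s)` becomes `(1 + ‖y‖)^(-s)` times a power
  -- of `1 + ‖y - r w‖` absorbed by `φ`. What is left is a polar integral, equal by translation
  -- invariance to one not depending on `y`.
  have hpt : ∀ r ∈ Ioi (1 : ℝ), r ^ (-a - 1) * ‖mean i φ y r‖ ≤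
      r ^ (m - 1) • ∫ w, D * (1 + ‖y - r • (w : Euc m)‖) ^ (-((m : ℝ) + 1)) ∂(sphereMeasure m) := by
    intro r hr
    have hr1 : 1 < r := hr
    have hr0 : 0 < r := by linarith
    have e1 : r ^ (-a - 1) = r ^ (m - 1) * r ^ (-s) := by
      rw [← Real.rpow_natCast, ← Real.rpow_add hr0]
      congr 1
      push_cast [Nat.cast_sub hm]
      rw [hs]; ring
    rw [e1, mul_assoc, smul_eq_mul]
    refine mul_le_mul_of_nonneg_left ?_ (by positivity)
    have hcont : Continuous fun w : Metric.sphere (0 : Euc m) 1 =>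
        D * (1 + ‖y - r • (w : Euc m)‖) ^ (-((m : ℝ) + 1)) := by
      refine continuous_const.mul (Continuous.rpow_const (by fun_prop) fun w => Or.inl ?_)
      positivity
    have hn : ‖((r ^ (-s) : ℝ) : ℂ) * mean i φ y r‖ = r ^ (-s) * ‖mean i φ y r‖ := by
      rw [norm_mul, Complex.norm_real, Real.norm_of_nonneg (by positivity)]
    rw [← hn, mean, ← integral_const_mul]
    refine norm_integral_le_of_norm_le
      (hcont.integrable_of_hasCompactSupport (HasCompactSupport.of_compactSpace _))
      (Eventually.of_forall fun w => ?_)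
    have hq : 0 < 1 + ‖y - r • (w : Euc m)‖ := by positivity
    have h1 := norm_wt_sphere_le i w
    have h2 := norm_le_snorm (K := K') (n := 0) φ (y - r • (w : Euc m))
    have h3 := rpow_one_add_norm_le (-s) (r • (w : Euc m)) y
    rw [norm_smul, norm_eq_of_mem_sphere w, mul_one, Real.norm_of_nonneg hr0.le, abs_neg] at h3
    have h4 := rpow_neg_le_two_rpow_mul s hr1.le
    have h5 : (1 + ‖y - r • (w : Euc m)‖) ^ |s| * (1 + ‖y - r • (w : Euc m)‖) ^ (-(K' : ℝ)) ≤
        (1 + ‖y - r • (w : Euc m)‖) ^ (-((m : ℝ) + 1)) := by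
      rw [← Real.rpow_add hq]
      refine Real.rpow_le_rpow_of_exponent_le (by linarith [norm_nonneg (y - r • (w : Euc m))]) ?_
      have : (K : ℝ) ≤ K' := by exact_mod_cast hK'
      linarith
    rw [norm_mul, Complex.norm_real, Real.norm_of_nonneg (by positivity), norm_mul]
    have hS := snorm_nonneg K' 0 φ
    calc r ^ (-s) * (‖wt i (w : Euc m)‖ * ‖φ (y - r • (w : Euc m))‖)
        ≤ (2 ^ |s| * ((1 + ‖y‖) ^ (-s) * (1 + ‖y - r • (w : Euc m)‖) ^ |s|)) *
          (1 * (snorm K' 0 φ * (1 + ‖y - r • (w : Euc m)‖) ^ (-(K' : ℝ)))) := by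
          gcongr
          exact h4.trans (mul_le_mul_of_nonneg_left h3 (by positivity))
      _ = D * ((1 + ‖y - r • (w : Euc m)‖) ^ |s| *
          (1 + ‖y - r • (w : Euc m)‖) ^ (-(K' : ℝ))) := by rw [hD]; ring
      _ ≤ _ := mul_le_mul_of_nonneg_left h5 hD0
  have hp1' := hp1.mono_set (Ioi_subset_Ioi (zero_le_one (α := ℝ)))
  have hcm : Continuous (mean i φ y) := (contDiff_mean i φ y 0).continuous
  have hint : IntegrableOn (fun r : ℝ => r ^ (-a - 1) * ‖mean i φ y r‖) (Ioi 1) := by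
    refine Integrable.mono' hp1' ?_ ?_
    · refine ContinuousOn.aestronglyMeasurable (ContinuousOn.mul ?_ hcm.norm.continuousOn)
        measurableSet_Ioi
      exact continuousOn_id.rpow_const fun r hr =>
        Or.inl (by have : (1 : ℝ) < r := hr; simp only [id]; positivity)
    · filter_upwards [ae_restrict_mem measurableSet_Ioi] with r hr
      have hr1 : (1 : ℝ) < r := hr
      rw [Real.norm_of_nonneg (by positivity)]
      exact hpt r hr
  refine ⟨hint, ?_⟩
  calc ∫ r in Ioi (1 : ℝ), r ^ (-a - 1) * ‖mean i φ y r‖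
      ≤ ∫ r in Ioi (1 : ℝ), r ^ (m - 1) •
          ∫ w, D * (1 + ‖y - r • (w : Euc m)‖) ^ (-((m : ℝ) + 1)) ∂(sphereMeasure m) :=
        setIntegral_mono_on hint hp1' measurableSet_Ioi hpt
    _ ≤ ∫ r in Ioi (0 : ℝ), r ^ (m - 1) •
          ∫ w, D * (1 + ‖y - r • (w : Euc m)‖) ^ (-((m : ℝ) + 1)) ∂(sphereMeasure m) := by
        refine setIntegral_mono_set hp1 ?_ (Ioi_subset_Ioi zero_le_one).eventuallyLE
        filter_upwards [ae_restrict_mem measurableSet_Ioi] with r hr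
        have hr0 : (0 : ℝ) < r := hr
        exact smul_nonneg (by positivity) (integral_nonneg fun w => mul_nonneg hD0 (by positivity))
    _ = D * ∫ x : Euc m, (1 + ‖x‖) ^ (-((m : ℝ) + 1)) := by
        rw [← hp2, integral_const_mul,
          integral_sub_left_eq_self (fun x : Euc m => (1 + ‖x‖) ^ (-((m : ℝ) + 1))) volume y]
    _ = _ := by rw [hD]; ring

/-! ### The regularized kernels: holomorphy in the exponent, uniform bounds, linearity. -/

/-- `finitePart (-z - 1)` of the spherical means of `φ (y - ·)`. -/
def rawReg (i : Option (Fin m)) (z : ℂ) (φ : 𝓢(Euc m, ℂ)) (y : Euc m) : ℂ :=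
  finitePart (-z - 1) (mean i φ y)

theorem rawReg_eq (i : Option (Fin m)) {z : ℂ} {N : ℕ} (hz : z.re < N) (φ : 𝓢(Euc m, ℂ))
    (y : Euc m) :
    rawReg i z φ y = mellin (taylorRem (mean i φ y) N) (-z) +
      ∑ k ∈ Finset.range N, dmean i φ k y 0 / (Nat.factorial k : ℂ) / (k - z) := by
  rw [rawReg, finitePart_eq (contDiff_mean i φ y) (mean_isBigO i φ y) hz]
  simp only [iteratedDeriv_mean]

/-- The complement of the poles of `rawReg`. -/
def poleFree (i : Option (Fin m)) : Set ℂ := {z | ∀ l : ℕ, z ≠ deg i + 2 * l}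

/-- The term with denominator `k - z` is harmless in two ways: for `k` of the wrong parity its
numerator vanishes, and for `k` of the right parity `z` avoids the pole. -/
theorem dmean_zero_or_ne (i : Option (Fin m)) {z : ℂ} (hz : z ∈ poleFree i) (k : ℕ) :
    (∀ (φ : 𝓢(Euc m, ℂ)) (y : Euc m), dmean i φ k y 0 = 0) ∨ (k : ℂ) - z ≠ 0 := by
  rcases Nat.even_or_odd (k + deg i) with h | h
  · right
    intro h0
    have hk : ∃ l, k = deg i + 2 * l := by
      cases i with
      | none =>
        simp only [deg, Option.elim] at h ⊢
        obtain ⟨l, hl⟩ := h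
        exact ⟨l, by omega⟩
      | some j =>
        simp only [deg, Option.elim] at h ⊢
        obtain ⟨l, hl⟩ := h
        exact ⟨l - 1, by omega⟩
    obtain ⟨l, rfl⟩ := hk
    refine hz l ?_
    push_cast at h0
    exact (sub_eq_zero.mp h0).symm
  · exact Or.inl fun φ y => dmean_at_zero_eq_zero i φ y k h

theorem differentiableAt_rawReg (i : Option (Fin m)) {z : ℂ} (hz : z ∈ poleFree i)
    (φ : 𝓢(Euc m, ℂ)) (y : Euc m) : DifferentiableAt ℂ (fun z => rawReg i z φ y) z := by
  obtain ⟨N, hN⟩ := exists_nat_gt z.re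
  have hev : (fun z => rawReg i z φ y) =ᶠ[𝓝 z] fun z => mellin (taylorRem (mean i φ y) N) (-z) +
      ∑ k ∈ Finset.range N, dmean i φ k y 0 / (Nat.factorial k : ℂ) / (k - z) := by
    filter_upwards [(isOpen_lt Complex.continuous_re continuous_const).mem_nhds hN] with z' hz'
    exact rawReg_eq i hz' φ y
  refine DifferentiableAt.congr_of_eventuallyEq ?_ hev
  refine (differentiableAt_mellin_taylorRem (contDiff_mean i φ y) (mean_isBigO i φ y) hN).add
    (DifferentiableAt.fun_sum fun k _ => ?_)
  rcases dmean_zero_or_ne i hz k with h | h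
  · simp [h]
  · exact (differentiableAt_const _).div ((differentiableAt_const _).sub differentiableAt_id) h

/-- After fixing `N`, the Mellin integrand is jointly measurable in `(y, r)`, and the Taylor
coefficients are continuous in `y`. -/
theorem stronglyMeasurable_rawReg (i : Option (Fin m)) (z : ℂ) (φ : 𝓢(Euc m, ℂ)) :
    StronglyMeasurable (rawReg i z φ) := by
  obtain ⟨N, hN⟩ := exists_nat_gt z.re
  have : rawReg i z φ = fun y => mellin (taylorRem (mean i φ y) N) (-z) +
      ∑ k ∈ Finset.range N, dmean i φ k y 0 / (Nat.factorial k : ℂ) / (k - z) :=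
    funext fun y => rawReg_eq i hN φ y
  rw [this]
  have hc0 : ∀ k, Continuous fun y => dmean i φ k y 0 := fun k =>
    (continuous_dmean i φ k).comp (Continuous.prodMk_left (0 : ℝ))
  refine StronglyMeasurable.add ?_ (Continuous.stronglyMeasurable ?_)
  · unfold mellin
    refine StronglyMeasurable.integral_prod_right (f := fun y r =>
      ((r : ℝ) : ℂ) ^ (-z - 1) • taylorRem (mean i φ y) N r) ?_
    have h1 : Measurable fun q : Euc m × ℝ => ((q.2 : ℝ) : ℂ) ^ (-z - 1) := by fun_prop
    have h2 : Measurable fun q : Euc m × ℝ => mean i φ q.1 q.2 := by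
      simp_rw [← dmean_zero]
      exact (continuous_dmean i φ 0).measurable
    have h3 : Measurable fun q : Euc m × ℝ =>
        (Ioc (0 : ℝ) 1).indicator (taylorPoly (mean i φ q.1) N) q.2 := by
      have h4 : Measurable fun q : Euc m × ℝ => taylorPoly (mean i φ q.1) N q.2 := by
        simp only [taylorPoly, iteratedDeriv_mean]
        refine Continuous.measurable (continuous_finsetSum _ fun k _ => ?_)
        have := (hc0 k).comp (continuous_fst (X := Euc m) (Y := ℝ))
        simp only [Function.comp_def] at this
        fun_prop
      exact h4.indicator (measurable_snd (measurableSet_Ioc (a := (0 : ℝ)) (b := 1)))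
    exact (h1.smul (h2.sub h3)).stronglyMeasurable
  · have := hc0
    fun_prop

theorem snorm_mono (K : ℕ) {n n' : ℕ} (h : n ≤ n') (φ : 𝓢(Euc m, ℂ)) :
    snorm K n φ ≤ snorm K n' φ := by
  unfold snorm
  refine mul_le_mul_of_nonneg_left ?_ (by positivity)
  have : (Finset.Iic (K, n)).sup (fun q => SchwartzMap.seminorm ℂ (F := ℂ) (E := Euc m) q.1 q.2) ≤
      (Finset.Iic (K, n')).sup fun q => SchwartzMap.seminorm ℂ q.1 q.2 :=
    Finset.sup_mono (Finset.Iic_subset_Iic.mpr (Prod.mk_le_mk.mpr ⟨le_rfl, h⟩))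
  exact this φ

theorem eventually_norm_le {g : ℂ → ℂ} {z₀ : ℂ} (h : ContinuousAt g z₀) :
    ∀ᶠ z in 𝓝 z₀, ‖g z‖ ≤ ‖g z₀‖ + 1 := by
  filter_upwards [h.norm.eventually_lt_const (lt_add_one ‖g z₀‖)] with z hz using hz.le

/-- The Taylor part decays rapidly in `y`, so the contribution of `r > 1` dictates the exponent. The
loss `ε` lets one bound serve all `z` near `z₀`. Explicit dependence on `φ` through `snorm` gives
temperedness as well. -/
theorem exists_norm_rawReg_le (hm : 1 ≤ m) (i : Option (Fin m)) {z₀ : ℂ} (hz₀ : z₀ ∈ poleFree i)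
    {ε : ℝ} (hε : 0 < ε) :
    ∃ (C : ℝ) (K N : ℕ), 0 ≤ C ∧ ∀ᶠ z in 𝓝 z₀, ∀ (φ : 𝓢(Euc m, ℂ)) (y : Euc m),
      ‖rawReg i z φ y‖ ≤ C * snorm K N φ * (1 + ‖y‖) ^ (-(m + z₀.re - ε)) := by
  obtain ⟨N, hN⟩ := exists_nat_gt (z₀.re + ε)
  obtain ⟨C₁, K₁, hC₁, hfar⟩ := exists_integral_far_le hm i (z₀.re - ε)
  -- This makes the rapid decay of the inner part at least as good as the power dictated by the
  -- outer part.
  obtain ⟨K₂, hK₂⟩ := exists_nat_ge (m + z₀.re - ε)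
  set K := max K₁ K₂ with hK
  set S : ℝ := (sphereMeasure m).real univ * 2 ^ K with hS
  have hS0 : 0 ≤ S := by positivity
  set M : ℝ := ∑ k ∈ Finset.range N, (‖((k : ℂ) - z₀)⁻¹‖ + 1) with hM
  have hM0 : 0 ≤ M := Finset.sum_nonneg fun k _ => by positivity
  have hNb : 0 < (N : ℝ) - (z₀.re + ε) := by linarith
  refine ⟨S / (N - (z₀.re + ε)) + C₁ + S * M, K, N, by positivity, ?_⟩
  have h1 : ∀ᶠ z in 𝓝 z₀, z.re < z₀.re + ε :=
    (isOpen_lt Complex.continuous_re continuous_const).mem_nhds (by simpa using hε)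
  have h2 : ∀ᶠ z in 𝓝 z₀, z₀.re - ε < z.re :=
    (isOpen_lt continuous_const Complex.continuous_re).mem_nhds (by simpa using hε)
  have h3 : ∀ᶠ z in 𝓝 z₀, ∀ k ∈ Finset.range N, ∀ (φ : 𝓢(Euc m, ℂ)) (y : Euc m),
      ‖dmean i φ k y 0 / (Nat.factorial k : ℂ) / (k - z)‖ ≤
        ‖dmean i φ k y 0‖ * (‖((k : ℂ) - z₀)⁻¹‖ + 1) := by
    rw [Filter.eventually_all_finset]
    intro k _
    rcases dmean_zero_or_ne i hz₀ k with h | h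
    · exact Eventually.of_forall fun z φ y => by simp [h]
    · have hc : ContinuousAt (fun z : ℂ => ((k : ℂ) - z)⁻¹) z₀ :=
        (continuousAt_const.sub continuousAt_id).inv₀ h
      filter_upwards [eventually_norm_le hc] with z hz φ y
      rw [div_eq_mul_inv, norm_mul]
      refine mul_le_mul ?_ hz (norm_nonneg _) (norm_nonneg _)
      rw [norm_div, Complex.norm_natCast]
      exact div_le_self (norm_nonneg _)
        (by exact_mod_cast Nat.one_le_iff_ne_zero.mpr k.factorial_ne_zero)
  filter_upwards [h1, h2, h3] with z hz1 hz2 hz3 φ y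
  set P : ℝ := (1 + ‖y‖) ^ (-(m + z₀.re - ε)) with hP
  have hP0 : 0 ≤ P := by positivity
  have hKP : (1 + ‖y‖) ^ (-(K : ℝ)) ≤ P := by
    refine Real.rpow_le_rpow_of_exponent_le (by linarith [norm_nonneg y]) ?_
    have : (K₂ : ℝ) ≤ K := by exact_mod_cast le_max_right _ _
    linarith
  have hsn := snorm_nonneg K N φ
  have hdm : ∀ k ≤ N, ∀ r ∈ Icc (0 : ℝ) 1, ‖dmean i φ k y r‖ ≤ S * snorm K N φ * P :=
    fun k hk r hr => (norm_dmean_le i (K := K) hk φ y hr).trans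
      (mul_le_mul_of_nonneg_left hKP (mul_nonneg hS0 hsn))
  obtain ⟨hi, hle⟩ := hfar K (le_max_left _ _) φ y
  have hmel := norm_mellin_taylorRem_le (N := N) (C := S * snorm K N φ * P) (z := z)
    (contDiff_mean i φ y) (mean_isBigO i φ y)
    (fun r hr => by rw [iteratedDeriv_mean]; exact hdm N le_rfl r hr) hz2.le hz1.le hN hi
  have hle' : C₁ * snorm K 0 φ * (1 + ‖y‖) ^ (-(m + (z₀.re - ε))) ≤ C₁ * snorm K N φ * P := by
    rw [hP, add_sub_assoc]
    exact mul_le_mul_of_nonneg_right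
      (mul_le_mul_of_nonneg_left (snorm_mono K (Nat.zero_le N) φ) hC₁) (by positivity)
  have hsum : ‖∑ k ∈ Finset.range N, dmean i φ k y 0 / (Nat.factorial k : ℂ) / (k - z)‖ ≤
      S * snorm K N φ * P * M := by
    rw [hM, Finset.mul_sum]
    refine (norm_sum_le _ _).trans (Finset.sum_le_sum fun k hk => (hz3 k hk φ y).trans ?_)
    exact mul_le_mul_of_nonneg_right (hdm k (Finset.mem_range.mp hk).le 0 (by simp)) (by positivity)
  rw [rawReg_eq i (hz1.trans hN)]
  refine (norm_add_le _ _).trans ?_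
  have := hmel.trans (add_le_add_right (hle.trans hle') _)
  calc _ ≤ S * snorm K N φ * P / (N - (z₀.re + ε)) + C₁ * snorm K N φ * P +
        S * snorm K N φ * P * M := add_le_add this hsum
    _ = _ := by ring

/-- The normalizing factor. -/
def cst (i : Option (Fin m)) (z : ℂ) : ℂ :=
  (-1) ^ deg i * 2 ^ z * (Real.pi : ℂ) ^ (-((m : ℂ) / 2)) * Complex.Gamma ((m + z + deg i) / 2) *
    (Complex.Gamma ((deg i - z) / 2))⁻¹

/-- The regularization of the kernel with Fourier symbol `(2π|ξ|)^z` times `1` or `i ξ_j / |ξ|`. -/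
def reg (i : Option (Fin m)) (z : ℂ) (φ : 𝓢(Euc m, ℂ)) (y : Euc m) : ℂ :=
  cst i z * rawReg i z φ y

/-- The set on which `reg` is holomorphic. -/
def dom (i : Option (Fin m)) : Set ℂ :=
  poleFree i ∩ {z | ∀ n : ℕ, z ≠ -((m : ℂ) + deg i + 2 * n)}

theorem differentiableAt_cst (i : Option (Fin m)) {z : ℂ} (hz : z ∈ dom i) :
    DifferentiableAt ℂ (cst i) z := by
  unfold cst
  refine DifferentiableAt.mul (DifferentiableAt.mul (DifferentiableAt.mul_const
    (DifferentiableAt.const_mul ?_ _) _) ?_) ?_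
  · exact differentiableAt_id.const_cpow (Or.inl two_ne_zero)
  · refine DifferentiableAt.comp z (f := fun z : ℂ => ((m : ℂ) + z + deg i) / 2)
      (Complex.differentiableAt_Gamma _ fun n hn => hz.2 n ?_) (by fun_prop)
    linear_combination 2 * hn
  · exact DifferentiableAt.comp z (f := fun z : ℂ => ((deg i : ℂ) - z) / 2)
      (Complex.differentiable_one_div_Gamma _) (by fun_prop)

theorem differentiableAt_reg (i : Option (Fin m)) {z : ℂ} (hz : z ∈ dom i)
    (φ : 𝓢(Euc m, ℂ)) (y : Euc m) : DifferentiableAt ℂ (fun z => reg i z φ y) z :=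
  (differentiableAt_cst i hz).mul (differentiableAt_rawReg i hz.1 φ y)

theorem stronglyMeasurable_reg (i : Option (Fin m)) (z : ℂ) (φ : 𝓢(Euc m, ℂ)) :
    StronglyMeasurable (reg i z φ) :=
  (stronglyMeasurable_rawReg i z φ).const_mul _

theorem exists_norm_reg_le (hm : 1 ≤ m) (i : Option (Fin m)) {z₀ : ℂ} (hz₀ : z₀ ∈ dom i)
    {ε : ℝ} (hε : 0 < ε) :
    ∃ (C : ℝ) (K N : ℕ), 0 ≤ C ∧ ∀ᶠ z in 𝓝 z₀, ∀ (φ : 𝓢(Euc m, ℂ)) (y : Euc m),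
      ‖reg i z φ y‖ ≤ C * snorm K N φ * (1 + ‖y‖) ^ (-(m + z₀.re - ε)) := by
  obtain ⟨C, K, N, hC, h⟩ := exists_norm_rawReg_le hm i hz₀.1 hε
  refine ⟨(‖cst i z₀‖ + 1) * C, K, N, by positivity, ?_⟩
  filter_upwards [h, eventually_norm_le (differentiableAt_cst i hz₀).continuousAt]
    with z h1 h2 φ y
  rw [reg, norm_mul, mul_assoc, mul_assoc, ← mul_assoc C]
  exact mul_le_mul h2 (h1 φ y) (norm_nonneg _) (by positivity)

theorem integrable_mean_integrand (i : Option (Fin m)) (φ : 𝓢(Euc m, ℂ)) (y : Euc m) (r : ℝ) :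
    Integrable (fun w : Metric.sphere (0 : Euc m) 1 => wt i (w : Euc m) * φ (y - r • (w : Euc m)))
      (sphereMeasure m) := by
  have h : Continuous fun w : Metric.sphere (0 : Euc m) 1 =>
      wt i (w : Euc m) * φ (y - r • (w : Euc m)) := by
    have := φ.continuous
    fun_prop
  exact h.integrable_of_hasCompactSupport (HasCompactSupport.of_compactSpace _)

theorem mean_add (i : Option (Fin m)) (φ ψ : 𝓢(Euc m, ℂ)) (y : Euc m) :
    mean i (φ + ψ) y = mean i φ y + mean i ψ y := by
  ext r
  simp only [mean, Pi.add_apply, _root_.add_apply, mul_add]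
  exact integral_add (integrable_mean_integrand i φ y r) (integrable_mean_integrand i ψ y r)

theorem mean_smul (i : Option (Fin m)) (c : ℂ) (φ : 𝓢(Euc m, ℂ)) (y : Euc m) :
    mean i (c • φ) y = fun r => c * mean i φ y r := by
  ext r
  simp only [mean, _root_.smul_apply, smul_eq_mul, ← integral_const_mul]
  congr 1
  ext w
  ring

theorem taylorRem_add {f g : ℝ → ℂ} {N : ℕ} (hf : ∀ n : ℕ, ContDiff ℝ n f)
    (hg : ∀ n : ℕ, ContDiff ℝ n g) : taylorRem (f + g) N = fun r => taylorRem f N r + taylorRem g N r := by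
  ext r
  have h : taylorPoly (f + g) N = taylorPoly f N + taylorPoly g N := by
    ext r
    simp only [taylorPoly, Pi.add_apply, ← Finset.sum_add_distrib]
    refine Finset.sum_congr rfl fun k _ => ?_
    rw [iteratedDeriv_add (hf k).contDiffAt (hg k).contDiffAt]
    ring
  rw [taylorRem, h, indicator_add']
  simp only [taylorRem, Pi.add_apply]
  ring

theorem rawReg_add (i : Option (Fin m)) (z : ℂ) (φ ψ : 𝓢(Euc m, ℂ)) (y : Euc m) :
    rawReg i z (φ + ψ) y = rawReg i z φ y + rawReg i z ψ y := by
  obtain ⟨N, hN⟩ := exists_nat_gt z.re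
  rw [rawReg_eq i hN, rawReg_eq i hN, rawReg_eq i hN, mean_add,
    taylorRem_add (contDiff_mean i φ y) (contDiff_mean i ψ y),
    (hasMellin_add (mellinConvergent_taylorRem (contDiff_mean i φ y) (mean_isBigO i φ y) hN)
      (mellinConvergent_taylorRem (contDiff_mean i ψ y) (mean_isBigO i ψ y) hN)).2,
    add_add_add_comm, ← Finset.sum_add_distrib]
  congr 1
  refine Finset.sum_congr rfl fun k _ => ?_
  rw [← iteratedDeriv_mean, mean_add,
    iteratedDeriv_add (contDiff_mean i φ y k).contDiffAt (contDiff_mean i ψ y k).contDiffAt,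
    iteratedDeriv_mean, iteratedDeriv_mean]
  ring

theorem finitePart_const_mul (z : ℂ) (c : ℂ) (f : ℝ → ℂ) :
    finitePart z (fun r => c * f r) = c * finitePart z f := by
  have h : ∀ k, iteratedDeriv k (fun r => c * f r) 0 = c * iteratedDeriv k f 0 :=
    fun k => iteratedDeriv_const_mul_field c f
  simp only [finitePart, h, mul_add, Finset.mul_sum, ← integral_const_mul]
  congr 1
  · congr 1
    · refine integral_congr_ae (Eventually.of_forall fun r => ?_)
      have h1 : ∑ k ∈ Finset.range ⌊-z.re⌋₊,
          c * iteratedDeriv k f 0 / (Nat.factorial k : ℂ) * (r : ℂ) ^ k =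
          c * ∑ k ∈ Finset.range ⌊-z.re⌋₊,
            iteratedDeriv k f 0 / (Nat.factorial k : ℂ) * (r : ℂ) ^ k := by
        rw [Finset.mul_sum]
        refine Finset.sum_congr rfl fun k _ => ?_
        ring
      simp only [h1]
      ring
    · refine integral_congr_ae (Eventually.of_forall fun r => ?_)
      change (r : ℂ) ^ z * (c * f r) = c * ((r : ℂ) ^ z * f r)
      ring
  · refine Finset.sum_congr rfl fun k _ => ?_
    ring

theorem rawReg_smul (i : Option (Fin m)) (z c : ℂ) (φ : 𝓢(Euc m, ℂ)) (y : Euc m) :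
    rawReg i z (c • φ) y = c * rawReg i z φ y := by
  rw [rawReg, mean_smul, finitePart_const_mul, rawReg]

/-- The continuous linear functional `φ ↦ rawReg i z φ 0`. -/
theorem exists_rawReg_clm (hm : 1 ≤ m) (i : Option (Fin m)) {z : ℂ} (hz : z ∈ poleFree i) :
    ∃ A : 𝓢(Euc m, ℂ) →L[ℂ] ℂ, ∀ φ, A φ = rawReg i z φ 0 := by
  obtain ⟨C, K, N, hC, h⟩ := exists_norm_rawReg_le hm i hz one_pos
  refine ⟨SchwartzMap.mkCLMtoNormedSpace (fun φ => rawReg i z φ 0)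
    (fun φ ψ => rawReg_add i z φ ψ 0) (fun c φ => rawReg_smul i z c φ 0)
    ⟨Finset.Iic (K, N), C * 2 ^ K, by positivity, fun φ => ?_⟩, fun φ => rfl⟩
  have := h.self_of_nhds φ 0
  rw [norm_zero, add_zero, Real.one_rpow, mul_one, snorm, ← mul_assoc] at this
  exact this

/-! ### Holomorphic parameter integrals and integrability of homogeneous weights. -/

/-- Holomorphy of an integral with a holomorphic, locally uniformly dominated integrand. -/
theorem differentiableAt_integral {α : Type*} [MeasurableSpace α] {ν : Measure α}
    {F : ℂ → α → ℂ} {z₀ : ℂ} {bound : α → ℝ}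
    (hmeas : ∀ᶠ z in 𝓝 z₀, AEStronglyMeasurable (F z) ν)
    (hb : Integrable bound ν)
    (h : ∃ V ∈ 𝓝 z₀, ∀ᵐ a ∂ν, ∀ z ∈ V, DifferentiableAt ℂ (fun z => F z a) z ∧ ‖F z a‖ ≤ bound a) :
    DifferentiableAt ℂ (fun z => ∫ a, F z a ∂ν) z₀ := by
  obtain ⟨V, hV, hVF⟩ := h
  obtain ⟨ρ, hρ, hball⟩ := Metric.mem_nhds_iff.mp (inter_mem hV hmeas)
  have hρ2 : 0 < ρ / 2 := by positivity
  have hmem : ∀ z ∈ Metric.ball z₀ ρ, z ∈ V := fun z hz => (hball hz).1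
  have hm : ∀ z ∈ Metric.ball z₀ ρ, AEStronglyMeasurable (F z) ν := fun z hz => (hball hz).2
  have hz₀ : z₀ ∈ Metric.ball z₀ ρ := Metric.mem_ball_self hρ
  -- Cauchy's estimate on circles of radius `ρ / 3`, which stay in the ball of radius `ρ` since `ρ /
  -- 2 + ρ / 3 < ρ`.
  have hderiv : ∀ᵐ a ∂ν, ∀ z ∈ Metric.ball z₀ (ρ / 2),
      ‖deriv (fun z => F z a) z‖ ≤ bound a / (ρ / 3) := by
    filter_upwards [hVF] with a ha z hz
    have hsub : Metric.closedBall z (ρ / 3) ⊆ Metric.ball z₀ ρ := fun w hw => by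
      rw [Metric.mem_ball] at hz ⊢
      rw [Metric.mem_closedBall] at hw
      linarith [dist_triangle w z z₀]
    refine Complex.norm_deriv_le_of_forall_mem_sphere_norm_le (by positivity) ?_ fun w hw =>
      (ha w (hmem w (hsub (Metric.sphere_subset_closedBall hw)))).2
    refine DifferentiableOn.diffContOnCl fun w hw => ?_
    have hw' := Metric.closure_ball_subset_closedBall hw
    exact (ha w (hmem w (hsub hw'))).1.differentiableWithinAt
  -- The derivative is an almost everywhere limit of difference quotients along a sequence of steps
  -- tending to `0`.
  have hmeas' : AEStronglyMeasurable (fun a => deriv (fun z => F z a) z₀) ν := by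
    set u : ℕ → ℂ := fun n => ((ρ / 2 / (n + 1) : ℝ) : ℂ) with hu
    have hu_pos : ∀ n : ℕ, 0 < ρ / 2 / ((n : ℝ) + 1) := fun n => by positivity
    have hu_ne : ∀ n, u n ≠ 0 := fun n => by
      rw [hu]; exact Complex.ofReal_ne_zero.mpr (hu_pos n).ne'
    have hu_lim : Tendsto u atTop (𝓝 0) := by
      have : Tendsto (fun n : ℕ => ρ / 2 / ((n : ℝ) + 1)) atTop (𝓝 0) :=
        tendsto_const_nhds.div_atTop (tendsto_natCast_atTop_atTop.atTop_add tendsto_const_nhds)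
      have h2 := (Complex.continuous_ofReal.tendsto 0).comp this
      rw [Complex.ofReal_zero] at h2
      exact h2
    refine aestronglyMeasurable_of_tendsto_ae atTop
      (f := fun n a => (u n)⁻¹ • (F (z₀ + u n) a - F z₀ a)) (fun n => ?_) ?_
    · have h1 : AEStronglyMeasurable (fun a => F (z₀ + u n) a - F z₀ a) ν :=
        (hm _ ?_).sub (hm _ hz₀)
      · exact h1.const_mul ((u n)⁻¹)
      rw [Metric.mem_ball, dist_eq_norm, add_sub_cancel_left, hu, Complex.norm_real,
        Real.norm_of_nonneg (hu_pos n).le]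
      have : ρ / 2 / ((n : ℝ) + 1) ≤ ρ / 2 := div_le_self hρ2.le (by linarith [n.cast_nonneg (α := ℝ)])
      linarith
    · filter_upwards [hVF] with a ha
      have hd := (ha z₀ (hmem _ hz₀)).1.hasDerivAt
      have := hasDerivAt_iff_tendsto_slope_zero.mp hd
      refine this.comp ?_
      exact tendsto_nhdsWithin_iff.mpr ⟨hu_lim, Eventually.of_forall hu_ne⟩
  refine (hasDerivAt_integral_of_dominated_loc_of_deriv_le (F := F)
    (F' := fun z a => deriv (fun z => F z a) z) (s := Metric.ball z₀ (ρ / 2))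
    (bound := fun a => bound a / (ρ / 3)) (Metric.ball_mem_nhds z₀ hρ2) hmeas ?_ hmeas' hderiv
    (hb.div_const _) ?_).2.differentiableAt
  · refine hb.mono' (hm _ hz₀) ?_
    filter_upwards [hVF] with a ha using (ha z₀ (hmem _ hz₀)).2
  · filter_upwards [hVF] with a ha z hz
    exact (ha z (hmem z (Metric.ball_subset_ball (by linarith) hz))).1.hasDerivAt

theorem integrable_norm_rpow_mul_one_add (hm : 1 ≤ m) {b : ℝ} (hb : -(m : ℝ) < b) {K : ℝ}
    (hK : m + b < K) (hK0 : 0 ≤ K) :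
    Integrable (fun x : Euc m => ‖x‖ ^ b * (1 + ‖x‖) ^ (-K)) := by
  have : Nonempty (Fin m) := ⟨⟨0, hm⟩⟩
  rw [integrable_fun_norm_addHaar volume (f := fun r : ℝ => r ^ b * (1 + r) ^ (-K))]
  have hfin : Module.finrank ℝ (Euc m) = m := by simp
  rw [hfin, ← Ioc_union_Ioi_eq_Ioi (zero_le_one (α := ℝ))]
  have hmeas : ∀ s : Set ℝ, AEStronglyMeasurable
      (fun r : ℝ => r ^ (m - 1) • (r ^ b * (1 + r) ^ (-K))) (volume.restrict s) := fun s =>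
    (Measurable.aestronglyMeasurable (by fun_prop))
  have hpow : ∀ r : ℝ, 0 < r → r ^ (m - 1) * r ^ b = r ^ ((m : ℝ) - 1 + b) := fun r hr => by
    rw [Real.rpow_add hr, ← Real.rpow_natCast, Nat.cast_sub hm, Nat.cast_one]
  refine IntegrableOn.union ?_ ?_
  · have h1 : IntervalIntegrable (fun r : ℝ => r ^ ((m : ℝ) - 1 + b)) volume 0 1 :=
      intervalIntegral.intervalIntegrable_rpow' (by linarith)
    refine Integrable.mono' ((intervalIntegrable_iff_integrableOn_Ioc_of_le zero_le_one).mp h1)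
      (hmeas _) ?_
    filter_upwards [ae_restrict_mem measurableSet_Ioc] with r hr
    have hr0 := hr.1
    rw [Real.norm_of_nonneg (by positivity), smul_eq_mul, ← mul_assoc, hpow r hr0]
    refine mul_le_of_le_one_right (by positivity) ?_
    exact Real.rpow_le_one_of_one_le_of_nonpos (by linarith) (neg_nonpos.mpr hK0)
  · refine Integrable.mono' (integrableOn_Ioi_rpow_of_lt (a := (m : ℝ) - 1 + b - K) (by linarith)
      one_pos) (hmeas _) ?_
    filter_upwards [ae_restrict_mem measurableSet_Ioi] with r hr
    have hr1 : (1 : ℝ) < r := hr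
    have hr0 : 0 < r := by linarith
    rw [Real.norm_of_nonneg (by positivity), smul_eq_mul, ← mul_assoc, hpow r hr0,
      sub_eq_add_neg _ K, Real.rpow_add hr0 _ (-K)]
    refine mul_le_mul_of_nonneg_left ?_ (by positivity)
    exact Real.rpow_le_rpow_of_nonpos hr0 (by linarith) (by linarith)

theorem integrable_norm_rpow_mul (hm : 1 ≤ m) {b : ℝ} (hb : -(m : ℝ) < b) (h : 𝓢(Euc m, ℂ)) :
    Integrable (fun x : Euc m => ‖x‖ ^ b * ‖h x‖) := by
  obtain ⟨K, hK⟩ := exists_nat_gt (m + b)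
  refine Integrable.mono' ((integrable_norm_rpow_mul_one_add hm hb hK K.cast_nonneg).const_mul
    (snorm K 0 h)) ?_ (Eventually.of_forall fun x => ?_)
  · have := h.continuous
    exact Measurable.aestronglyMeasurable (by fun_prop)
  · rw [Real.norm_of_nonneg (by positivity)]
    calc ‖x‖ ^ b * ‖h x‖ ≤ ‖x‖ ^ b * (snorm K 0 h * (1 + ‖x‖) ^ (-(K : ℝ))) := by
          gcongr; exact norm_le_snorm h x
      _ = _ := by ring

theorem norm_wt_mul_le (i : Option (Fin m)) (b : ℝ) {x : Euc m} (hx : x ≠ 0) :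
    ‖wt i x‖ * ‖x‖ ^ (b - deg i) ≤ ‖x‖ ^ b := by
  have h := norm_wt_le i x
  have hx0 : 0 < ‖x‖ := norm_pos_iff.mpr hx
  rw [Real.rpow_sub hx0, Real.rpow_natCast, mul_div_assoc', div_le_iff₀ (by positivity), mul_comm]
  gcongr

theorem ae_ne_zero (hm : 1 ≤ m) : ∀ᵐ x : Euc m, x ≠ 0 := by
  have : Nonempty (Fin m) := ⟨⟨0, hm⟩⟩
  exact Measure.ae_ne volume 0

/-- The function `Y(x) |x|^(a - deg Y) h(x)` is integrable for `Re a > -m`. -/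
theorem integrable_cpow_mul_wt_mul (hm : 1 ≤ m) (i : Option (Fin m)) {a : ℂ}
    (ha : -(m : ℝ) < a.re) (h : 𝓢(Euc m, ℂ)) :
    Integrable (fun x : Euc m => (‖x‖ : ℂ) ^ (a - deg i) * (wt i x * h x)) := by
  refine Integrable.mono' (integrable_norm_rpow_mul hm ha h) ?_ ?_
  · have h1 := h.continuous
    have h2 := continuous_wt i
    exact Measurable.aestronglyMeasurable (by fun_prop)
  · filter_upwards [ae_ne_zero hm] with x hx
    have hx0 : 0 < ‖x‖ := norm_pos_iff.mpr hx
    rw [norm_mul, norm_mul, Complex.norm_cpow_eq_rpow_re_of_pos hx0, ← mul_assoc]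
    have := norm_wt_mul_le i a.re hx
    simp only [Complex.sub_re, Complex.natCast_re]
    rw [mul_comm (‖x‖ ^ _)]
    gcongr

/-! ### Gaussians and the Fourier symbol of the kernels. -/

/-- The Gaussian `exp (-π t |x|²)`. -/
def gauss (t : ℝ) (x : Euc m) : ℂ := Complex.exp (-((Real.pi * t : ℝ) : ℂ) * (‖x‖ : ℂ) ^ 2)

theorem norm_gauss (t : ℝ) (x : Euc m) : ‖gauss t x‖ = Real.exp (-(Real.pi * t) * ‖x‖ ^ 2) := by
  rw [gauss, Complex.norm_exp]
  congr 1
  norm_cast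

theorem norm_gauss_le_one {t : ℝ} (ht : 0 < t) (x : Euc m) : ‖gauss t x‖ ≤ 1 := by
  rw [norm_gauss, Real.exp_le_one_iff]
  have := Real.pi_pos
  have : 0 ≤ (Real.pi * t) * ‖x‖ ^ 2 := by positivity
  linarith

theorem continuous_gauss : Continuous fun q : ℝ × Euc m => gauss q.1 q.2 := by
  unfold gauss
  fun_prop

theorem continuous_gauss_right (t : ℝ) : Continuous (gauss t : Euc m → ℂ) := by
  unfold gauss
  fun_prop

theorem integrable_gauss {t : ℝ} (ht : 0 < t) : Integrable (gauss t : Euc m → ℂ) := by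
  have hb : 0 < (((Real.pi * t : ℝ) : ℂ)).re := by
    rw [Complex.ofReal_re]; have := Real.pi_pos; positivity
  have := GaussianFourier.integrable_cexp_neg_mul_sq_norm_add hb 0 (0 : Euc m)
  refine this.congr (Eventually.of_forall fun x => ?_)
  simp [gauss]

theorem fourier_gauss {t : ℝ} (ht : 0 < t) (w : Euc m) :
    𝓕 (gauss t⁻¹ : Euc m → ℂ) w = (t : ℂ) ^ ((m : ℂ) / 2) * gauss t w := by
  have hpi := Real.pi_pos
  have hb : 0 < (((Real.pi * t⁻¹ : ℝ) : ℂ)).re := by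
    rw [Complex.ofReal_re]; positivity
  have hpi' : (Real.pi : ℂ) ≠ 0 := by exact_mod_cast hpi.ne'
  have ht' : (t : ℂ) ≠ 0 := by exact_mod_cast ht.ne'
  have := fourier_gaussian_innerProductSpace hb w
  have h1 : (gauss t⁻¹ : Euc m → ℂ) = fun v : Euc m =>
    Complex.exp (-((Real.pi * t⁻¹ : ℝ) : ℂ) * (‖v‖ : ℂ) ^ 2) := rfl
  rw [h1, this]
  congr 1
  · congr 1
    · push_cast; field_simp
    · simp
  · unfold gauss
    congr 1
    push_cast
    field_simp

theorem integral_gauss_mul {t : ℝ} (ht : 0 < t) (g : 𝓢(Euc m, ℂ)) :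
    ∫ x, gauss t x * g x = (t : ℂ) ^ (-((m : ℂ) / 2)) * ∫ x, gauss t⁻¹ x * 𝓕 g x := by
  have h := VectorFourier.integral_bilin_fourierIntegral_eq_flip (ContinuousLinearMap.mul ℂ ℂ)
    (L := innerₗ (Euc m)) (μ := volume) (ν := volume) Real.continuous_fourierChar continuous_inner
    (integrable_gauss (m := m) (inv_pos.mpr ht)) g.integrable
  have h2 : ∫ x, 𝓕 (gauss t⁻¹ : Euc m → ℂ) x * g x = ∫ x, gauss t⁻¹ x * 𝓕 g x := by
    simpa using! h
  have ht' : (t : ℂ) ≠ 0 := by exact_mod_cast ht.ne'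
  rw [← h2]
  simp_rw [fourier_gauss ht, mul_assoc]
  rw [integral_const_mul, ← mul_assoc, ← Complex.cpow_add _ _ ht', neg_add_cancel,
    Complex.cpow_zero, one_mul]

theorem hasFDerivAt_gauss (t : ℝ) (x v : Euc m) :
    DifferentiableAt ℝ (gauss t : Euc m → ℂ) x ∧ fderiv ℝ (gauss t : Euc m → ℂ) x v =
      -(2 * Real.pi * t : ℂ) * (inner ℝ x v : ℝ) * gauss t x := by
  have h1 : HasFDerivAt (fun x : Euc m => ‖x‖ ^ 2) (2 • innerSL ℝ x) x :=
    (hasStrictFDerivAt_norm_sq x).hasFDerivAt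
  have h2 : HasFDerivAt (fun x : Euc m => (((-(Real.pi * t)) * ‖x‖ ^ 2 : ℝ) : ℂ))
      (Complex.ofRealCLM.comp ((-(Real.pi * t)) • (2 • innerSL ℝ x))) x :=
    Complex.ofRealCLM.hasFDerivAt.comp x (h1.const_mul (-(Real.pi * t)))
  have h3 := h2.cexp
  have h4 : (gauss t : Euc m → ℂ) = fun x =>
      Complex.exp (((-(Real.pi * t)) * ‖x‖ ^ 2 : ℝ) : ℂ) := by
    ext x; simp [gauss]
  rw [h4]
  refine ⟨h3.differentiableAt, ?_⟩
  rw [h3.fderiv]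
  simp
  ring

/-- `∫ Y exp(-π t |x|²) g = i^p t^(-m/2-p) ∫ Y exp(-π |x|² / t) ĝ` for `Y` of degree `p`. -/
theorem integral_wt_gauss_mul (i : Option (Fin m)) {t : ℝ} (ht : 0 < t) (g : 𝓢(Euc m, ℂ)) :
    ∫ x, wt i x * gauss t x * g x = Complex.I ^ deg i * (t : ℂ) ^ (-((m : ℂ) / 2) - deg i) *
      ∫ x, wt i x * gauss t⁻¹ x * 𝓕 g x := by
  cases i with
  | none => simpa [wt, deg] using integral_gauss_mul ht g
  | some j =>
    have ht' : (t : ℂ) ≠ 0 := by exact_mod_cast ht.ne'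
    have hpi' : (Real.pi : ℂ) ≠ 0 := by exact_mod_cast Real.pi_ne_zero
    set v : Euc m := EuclideanSpace.single j (1 : ℝ) with hv
    have hinner : ∀ x : Euc m, inner ℝ x v = x j := fun x => by
      rw [hv, EuclideanSpace.inner_single_right]; simp
    have hf : ∀ x, fderiv ℝ (gauss t : Euc m → ℂ) x v = -(2 * Real.pi * t : ℂ) * x j * gauss t x :=
      fun x => by rw [(hasFDerivAt_gauss t x v).2, hinner]
    have hcg := continuous_gauss_right (m := m) t
    have hxg : Integrable fun x : Euc m => ((x j : ℝ) : ℂ) * gauss t x * g x := by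
      have h1 := integrable_norm_rpow_mul (m := m) (Fin.pos j) (b := 1)
        (by have := (Nat.cast_nonneg m : (0 : ℝ) ≤ m); linarith) g
      refine Integrable.mono' h1 ?_ (Eventually.of_forall fun x => ?_)
      · have := g.continuous
        exact Continuous.aestronglyMeasurable (by fun_prop)
      · rw [Real.rpow_one, norm_mul, norm_mul]
        have h2 := norm_gauss_le_one ht x
        have h3 := PiLp.norm_apply_le x j
        rw [← Complex.norm_real] at h3
        calc _ ≤ ‖x‖ * 1 * ‖g x‖ := by gcongr
          _ = _ := by ring
    -- The vector case is the scalar identity applied to `∂_j g`: integration by parts produces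
    -- `x_j` on one side, the Fourier transform of a derivative produces it on the other.
    have hbp : ∫ x, gauss t x * fderiv ℝ g x v = -∫ x, fderiv ℝ (gauss t : Euc m → ℂ) x v * g x := by
      refine integral_mul_fderiv_eq_neg_fderiv_mul_of_integrable ?_ ?_ ?_
        (fun x _ => (hasFDerivAt_gauss t x v).1) (fun x _ => g.differentiable x)
      · simp_rw [hf]
        refine (hxg.const_mul (-(2 * Real.pi * t : ℂ))).congr (Eventually.of_forall fun x => ?_)
        simp only
        ring
      · exact (∂_{v} g).integrable.bdd_mul hcg.aestronglyMeasurable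
          (Eventually.of_forall fun x => norm_gauss_le_one ht x)
      · exact g.integrable.bdd_mul hcg.aestronglyMeasurable
          (Eventually.of_forall fun x => norm_gauss_le_one ht x)
    have h0 := integral_gauss_mul ht (∂_{v} g)
    have h1 : ∀ x, (∂_{v} g) x = fderiv ℝ g x v := fun x => rfl
    have htg : Function.HasTemperateGrowth (fun x : Euc m => inner ℝ x v) := by fun_prop
    have h2 : ∀ x, 𝓕 (∂_{v} g) x = 2 * Real.pi * Complex.I * (x j : ℂ) * 𝓕 g x := fun x => by
      rw [SchwartzMap.fourier_lineDerivOp_eq]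
      rw [_root_.smul_apply, SchwartzMap.smulLeftCLM_apply_apply htg, hinner, smul_eq_mul,
        Complex.real_smul]
      ring
    simp_rw [h1, h2, hbp, hf] at h0
    have e1 : ∫ x : Euc m, -(2 * Real.pi * t : ℂ) * (x j : ℂ) * gauss t x * g x =
        -(2 * Real.pi * t : ℂ) * ∫ x : Euc m, (x j : ℂ) * gauss t x * g x := by
      rw [← integral_const_mul]; congr 1; ext x; ring
    have e2 : ∫ x : Euc m, gauss t⁻¹ x * (2 * Real.pi * Complex.I * (x j : ℂ) * 𝓕 g x) =
        (2 * Real.pi * Complex.I) * ∫ x : Euc m, (x j : ℂ) * gauss t⁻¹ x * 𝓕 g x := by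
      rw [← integral_const_mul]; congr 1; ext x; ring
    rw [e1, e2] at h0
    simp only [wt, deg, Option.elim, pow_one, Nat.cast_one]
    rw [Complex.cpow_sub _ _ ht', Complex.cpow_one]
    generalize ∫ x : Euc m, (x j : ℂ) * gauss t⁻¹ x * 𝓕 g x = J at h0 ⊢
    field_simp
    have h3 : (2 * Real.pi : ℂ) ≠ 0 := by simp [hpi']
    apply mul_left_cancel₀ h3
    linear_combination h0

/-- The Mellin transform in `t` of `∫ Y exp(-π t |x|²) h`. -/
theorem mellin_integral_gauss (hm : 1 ≤ m) (i : Option (Fin m)) {s : ℂ} (hs : 0 < s.re)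
    (hs' : 2 * s.re < m + deg i) (h : 𝓢(Euc m, ℂ)) :
    mellin (fun t : ℝ => ∫ x, wt i x * gauss t x * h x) s =
      (Real.pi : ℂ) ^ (-s) * Complex.Gamma s * ∫ x, (‖x‖ : ℂ) ^ (-(2 * s)) * (wt i x * h x) := by
  have hpi := Real.pi_pos
  set Φ : ℝ × Euc m → ℂ := fun q => (q.1 : ℂ) ^ (s - 1) * (wt i q.2 * gauss q.1 q.2 * h q.2)
  have hnorm : ∀ x : Euc m, x ≠ 0 → ∀ t ∈ Ioi (0 : ℝ), ‖Φ (t, x)‖ =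
      ‖wt i x * h x‖ * (t ^ (s.re - 1) * Real.exp (-((Real.pi * ‖x‖ ^ 2) * t))) := by
    intro x hx t ht
    have ht0 : 0 < t := ht
    simp only [Φ, norm_mul, norm_gauss]
    rw [Complex.norm_cpow_eq_rpow_re_of_pos ht0, Complex.sub_re, Complex.one_re]
    ring_nf
  have hmeas : AEStronglyMeasurable Φ ((volume.restrict (Ioi (0 : ℝ))).prod volume) := by
    have h1 := h.continuous
    have h2 := continuous_wt i
    have h3 := continuous_gauss (m := m)
    have h4 : Measurable fun q : ℝ × Euc m => (q.1 : ℂ) ^ (s - 1) := by fun_prop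
    have h5 : Measurable fun q : ℝ × Euc m => wt i q.2 * gauss q.1 q.2 * h q.2 :=
      Continuous.measurable (by fun_prop)
    exact (h4.mul h5).aestronglyMeasurable
  have hR : ∀ x : Euc m, x ≠ 0 → 0 < Real.pi * ‖x‖ ^ 2 := fun x hx => by
    have := norm_pos_iff.mpr hx
    positivity
  have hint : Integrable Φ ((volume.restrict (Ioi (0 : ℝ))).prod volume) := by
    rw [integrable_prod_iff' hmeas]
    constructor
    · filter_upwards [ae_ne_zero hm] with x hx
      have h1 := (integrableOn_rpow_mul_exp_neg_mul_rpow (p := 1) (s := s.re - 1) (by linarith)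
        one_pos (hR x hx)).const_mul ‖wt i x * h x‖
      refine Integrable.mono' h1 ?_ ?_
      · have h4 : Measurable fun t : ℝ => (t : ℂ) ^ (s - 1) := by fun_prop
        have h5 : Measurable fun t : ℝ => wt i x * gauss t x * h x := by
          have h3 := (continuous_gauss (m := m)).comp (Continuous.prodMk_left x)
          exact ((continuous_const.mul h3).mul continuous_const).measurable
        exact (h4.mul h5).aestronglyMeasurable
      · filter_upwards [ae_restrict_mem measurableSet_Ioi] with t ht
        rw [hnorm x hx t ht]
        simp
    -- Integrating the norm over `t` leaves at most a constant times `‖x‖^(deg i - 2 Re s) ‖h x‖`;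
    -- `hs'` says that this exponent exceeds `-m`.
    · have h1 := (integrable_norm_rpow_mul hm (b := deg i - 2 * s.re) (by linarith) h).const_mul
        (Real.pi ^ (-s.re) * Real.Gamma s.re)
      refine Integrable.mono' h1 hmeas.norm.prod_swap.integral_prod_right' ?_
      filter_upwards [ae_ne_zero hm] with x hx
      have hx0 : 0 < ‖x‖ := norm_pos_iff.mpr hx
      rw [setIntegral_congr_fun measurableSet_Ioi (hnorm x hx), integral_const_mul,
        Real.integral_rpow_mul_exp_neg_mul_Ioi hs (hR x hx), one_div,
        Real.inv_rpow (hR x hx).le, ← Real.rpow_neg (hR x hx).le,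
        Real.mul_rpow hpi.le (by positivity), ← Real.rpow_natCast, ← Real.rpow_mul hx0.le]
      have hG := Real.Gamma_pos_of_pos hs
      have h2 := norm_wt_mul_le i (deg i - 2 * s.re) hx
      rw [Real.norm_of_nonneg (by positivity), norm_mul]
      have h3 : ‖wt i x‖ ≤ ‖x‖ ^ ((deg i : ℝ)) := by
        rw [Real.rpow_natCast]; exact norm_wt_le i x
      have h4 : ‖x‖ ^ ((deg i : ℝ) - 2 * s.re) =
          ‖x‖ ^ ((deg i : ℝ)) * ‖x‖ ^ (((2 : ℕ) : ℝ) * -s.re) := by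
        rw [← Real.rpow_add hx0]; congr 1; push_cast; ring
      rw [h4]
      calc _ ≤ ‖x‖ ^ (deg i : ℝ) * ‖h x‖ * (Real.pi ^ (-s.re) * ‖x‖ ^ (((2 : ℕ) : ℝ) * -s.re) *
            Real.Gamma s.re) := by gcongr
        _ = _ := by ring
  have hswap := integral_integral_swap (f := fun t x => Φ (t, x)) hint
  rw [mellin]
  have e1 : ∀ t : ℝ, (t : ℂ) ^ (s - 1) • ∫ x, wt i x * gauss t x * h x = ∫ x, Φ (t, x) := fun t => by
    rw [smul_eq_mul, ← integral_const_mul]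
  simp_rw [e1]
  rw [hswap, ← integral_const_mul]
  refine integral_congr_ae ?_
  filter_upwards [ae_ne_zero hm] with x hx
  have hx0 : 0 < ‖x‖ := norm_pos_iff.mpr hx
  have e2 : ∀ t : ℝ, Φ (t, x) = (wt i x * h x) *
      ((t : ℂ) ^ (s - 1) * Complex.exp (-(((Real.pi * ‖x‖ ^ 2 : ℝ) : ℂ) * t))) := fun t => by
    simp only [Φ, gauss]
    push_cast
    ring_nf
  simp_rw [e2]
  rw [integral_const_mul, Complex.integral_cpow_mul_exp_neg_mul_Ioi hs (hR x hx), one_div,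
    Complex.inv_cpow _ _ (by
      rw [Complex.arg_ofReal_of_nonneg (hR x hx).le]; exact Real.pi_ne_zero.symm),
    ← Complex.cpow_neg]
  have e3 : (((Real.pi * ‖x‖ ^ 2 : ℝ)) : ℂ) ^ (-s) =
      (Real.pi : ℂ) ^ (-s) * (‖x‖ : ℂ) ^ (-(2 * s)) := by
    rw [Complex.ofReal_mul, Complex.mul_cpow_ofReal_nonneg hpi.le (by positivity)]
    congr 1
    rw [pow_two, Complex.ofReal_mul, Complex.mul_cpow_ofReal_nonneg hx0.le hx0.le,
      ← Complex.cpow_add _ _ (by exact_mod_cast hx0.ne')]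
    congr 1
    ring
  rw [e3]
  ring

/-- For `Re z < 0` no Taylor terms are needed: `N = 0` is allowed, and the finite part is an
ordinary integral in polar coordinates. -/
theorem rawReg_eq_integral (hm : 1 ≤ m) (i : Option (Fin m)) {z : ℂ} (hz : z.re < 0)
    (φ : 𝓢(Euc m, ℂ)) (y : Euc m) :
    rawReg i z φ y =
      ∫ x : Euc m, (‖x‖ : ℂ) ^ (-(m : ℂ) - z - deg i) * (wt i x * reflectAt y φ x) := by
  have hint := integrable_cpow_mul_wt_mul hm i (a := -(m : ℂ) - z) (by simp; linarith)
    (reflectAt y φ)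
  rw [(integral_polar hm hint).2, rawReg_eq i (N := 0) (by simpa using hz), mellin]
  simp only [Finset.range_zero, Finset.sum_empty, add_zero]
  refine setIntegral_congr_fun measurableSet_Ioi fun r hr => ?_
  have hr0 : (0 : ℝ) < r := hr
  have hrc : (r : ℂ) ≠ 0 := by exact_mod_cast hr0.ne'
  have h1 : taylorRem (mean i φ y) 0 r = mean i φ y r := by simp [taylorRem, taylorPoly]
  simp only [h1, mean, smul_eq_mul, Complex.real_smul]
  rw [← integral_const_mul, ← integral_const_mul]
  congr 1
  ext w
  rw [reflectAt_apply, wt_smul, norm_smul, norm_eq_of_mem_sphere w, mul_one,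
    Real.norm_of_nonneg hr0.le]
  have e1 : (r : ℂ) ^ (-z - 1) =
      ((r ^ (m - 1) : ℝ) : ℂ) * ((r : ℂ) ^ (-(m : ℂ) - z - deg i) * (r : ℂ) ^ deg i) := by
    push_cast
    rw [← Complex.cpow_natCast, ← Complex.cpow_natCast, ← Complex.cpow_add _ _ hrc,
      ← Complex.cpow_add _ _ hrc]
    congr 1
    rw [Nat.cast_sub hm]
    push_cast
    ring
  rw [e1]
  ring

/-- The Fourier symbol `(2π|ξ|)^z` times `1` or `i ξ_j / |ξ|`. -/
def symb (i : Option (Fin m)) (z : ℂ) (ξ : Euc m) : ℂ :=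
  (2 * Real.pi : ℂ) ^ z * Complex.I ^ deg i * ((‖ξ‖ : ℂ) ^ (z - deg i) * wt i ξ)

/-- Pair the Gaussian identity with `t^(s-1)`: the substitution `t ↦ t⁻¹` turns the exponent `s =
(deg i - z) / 2` into `s' = (m + z + deg i) / 2`. The two Mellin transforms give the two sides, and
`cst` collects the ratio of their Gamma factors and powers of `π`. The bounds on `Re z` make both
transforms converge. -/
theorem reg_eq_integral_of_neg (hm : 1 ≤ m) (i : Option (Fin m)) {z : ℂ} (hz : z.re < 0)
    (hz' : -1 < z.re) (φ : 𝓢(Euc m, ℂ)) (y : Euc m) :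
    reg i z φ y = ∫ ξ : Euc m, symb i z ξ * (𝓕⁻ (reflectAt y φ)) ξ := by
  set g : 𝓢(Euc m, ℂ) := 𝓕⁻ (reflectAt y φ) with hg
  have hFg : 𝓕 g = reflectAt y φ := FourierTransform.fourier_fourierInv_eq _
  have hm1 : (1 : ℝ) ≤ m := by exact_mod_cast hm
  have hp0 : (0 : ℝ) ≤ deg i := Nat.cast_nonneg _
  set s : ℂ := ((deg i : ℂ) - z) / 2 with hs
  set s' : ℂ := ((m : ℂ) + z + deg i) / 2 with hs'
  have hsre : s.re = (deg i - z.re) / 2 := by simp [hs]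
  have hsre' : s'.re = (m + z.re + deg i) / 2 := by simp [hs']
  have hA := mellin_integral_gauss hm i (s := s) (by rw [hsre]; linarith) (by rw [hsre]; linarith) g
  have hB := mellin_integral_gauss hm i (s := s') (by rw [hsre']; linarith)
    (by rw [hsre']; linarith) (𝓕 g)
  have hAB : mellin (fun t : ℝ => ∫ x, wt i x * gauss t x * g x) s =
      Complex.I ^ deg i * mellin (fun t : ℝ => ∫ x, wt i x * gauss t x * 𝓕 g x) s' := by
    have h1 : s' = -(s + (-((m : ℂ) / 2) - deg i)) := by rw [hs, hs']; ring
    rw [h1, ← mellin_comp_inv (fun t : ℝ => ∫ x, wt i x * gauss t x * 𝓕 g x), ← mellin_cpow_smul,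
      ← smul_eq_mul, ← mellin_const_smul]
    refine setIntegral_congr_fun measurableSet_Ioi fun t ht => ?_
    simp only [integral_wt_gauss_mul i ht g, smul_eq_mul]
    ring
  rw [hA, hB, hFg] at hAB
  have e1 : -(2 * s) = z - deg i := by rw [hs]; ring
  have e2 : -(2 * s') = -(m : ℂ) - z - deg i := by rw [hs']; ring
  rw [e1, e2, ← rawReg_eq_integral hm i hz] at hAB
  have hG : Complex.Gamma s ≠ 0 := Complex.Gamma_ne_zero_of_re_pos (by rw [hsre]; linarith)
  have hpi : (Real.pi : ℂ) ≠ 0 := by exact_mod_cast Real.pi_ne_zero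
  have hpis : (Real.pi : ℂ) ^ (-s) ≠ 0 := by simp [Complex.cpow_eq_zero_iff, hpi]
  have e3 : (Real.pi : ℂ) ^ (-s') * (Real.pi : ℂ) ^ z =
      (Real.pi : ℂ) ^ (-s) * (Real.pi : ℂ) ^ (-((m : ℂ) / 2)) := by
    rw [← Complex.cpow_add _ _ hpi, ← Complex.cpow_add _ _ hpi]
    congr 1
    rw [hs, hs']; ring
  have e4 : (2 * Real.pi : ℂ) ^ z = 2 ^ z * (Real.pi : ℂ) ^ z := by
    have := Complex.mul_cpow_ofReal_nonneg (a := 2) (b := Real.pi) (by norm_num) Real.pi_pos.le z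
    simpa using this
  have e5 : Complex.I ^ deg i * Complex.I ^ deg i = (-1) ^ deg i := by
    rw [← mul_pow, Complex.I_mul_I]
  have e6 : ∀ ξ : Euc m, symb i z ξ * g ξ = (2 * Real.pi : ℂ) ^ z * Complex.I ^ deg i *
      ((‖ξ‖ : ℂ) ^ (z - deg i) * (wt i ξ * g ξ)) := fun ξ => by rw [symb]; ring
  simp_rw [e6]
  rw [integral_const_mul, reg, cst, e4, ← hs, ← hs']
  generalize (∫ x : Euc m, (‖x‖ : ℂ) ^ (z - deg i) * (wt i x * g x)) = J at hAB ⊢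
  generalize rawReg i z φ y = R at hAB ⊢
  have e7 : J = (Real.pi : ℂ) ^ (-s') * (Complex.I ^ deg i * Complex.Gamma s' * R) /
      ((Real.pi : ℂ) ^ (-s) * Complex.Gamma s) := by
    rw [eq_div_iff (mul_ne_zero hpis hG)]
    linear_combination hAB
  rw [e7, ← e5]
  field_simp
  linear_combination (-Complex.Gamma s' * R) * e3

/-! ### Analytic continuation of the Fourier representation. -/

/-- The inverse Fourier transform of `φ (y - ·)` is `exp (2π i ⟨y, ξ⟩) φ̂`. -/
theorem fourierInv_reflectAt (φ : 𝓢(Euc m, ℂ)) (y ξ : Euc m) :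
    (𝓕⁻ (reflectAt y φ)) ξ =
      Complex.exp (((2 * Real.pi * inner ℝ y ξ : ℝ) : ℂ) * Complex.I) * (𝓕 φ) ξ := by
  rw [SchwartzMap.fourierInv_coe, Real.fourierInv_eq', SchwartzMap.fourier_coe, Real.fourier_eq',
    ← integral_const_mul, ← integral_sub_left_eq_self _ volume y]
  congr 1
  ext x
  rw [reflectAt_apply, sub_sub_cancel, smul_eq_mul, smul_eq_mul, ← mul_assoc, ← Complex.exp_add]
  congr 2
  rw [inner_sub_left]
  push_cast
  ring

theorem norm_symb_le (i : Option (Fin m)) (z : ℂ) {ξ : Euc m} (hξ : ξ ≠ 0) :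
    ‖symb i z ξ‖ ≤ (2 * Real.pi) ^ z.re * ‖ξ‖ ^ z.re := by
  have hξ0 : 0 < ‖ξ‖ := norm_pos_iff.mpr hξ
  have h2pi : 0 < 2 * Real.pi := by have := Real.pi_pos; positivity
  have h1 : (2 * Real.pi : ℂ) = ((2 * Real.pi : ℝ) : ℂ) := by push_cast; rfl
  have h2 := norm_wt_mul_le i z.re hξ
  rw [symb, norm_mul, norm_mul, norm_mul, h1, Complex.norm_cpow_eq_rpow_re_of_pos h2pi,
    Complex.norm_cpow_eq_rpow_re_of_pos hξ0, norm_pow, Complex.norm_I, one_pow, mul_one,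
    Complex.sub_re, Complex.natCast_re, mul_comm (‖ξ‖ ^ _)]
  gcongr

theorem measurable_symb (i : Option (Fin m)) (z : ℂ) : Measurable (symb i z) := by
  have h2 := continuous_wt i
  unfold symb
  fun_prop

theorem integrable_symb_mul (hm : 1 ≤ m) (i : Option (Fin m)) {z : ℂ} (hz : -(m : ℝ) < z.re)
    (g : 𝓢(Euc m, ℂ)) : Integrable (fun ξ => symb i z ξ * g ξ) := by
  refine Integrable.mono' ((integrable_norm_rpow_mul hm hz g).const_mul ((2 * Real.pi) ^ z.re))
    ((measurable_symb i z).mul g.continuous.measurable).aestronglyMeasurable ?_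
  filter_upwards [ae_ne_zero hm] with ξ hξ
  rw [norm_mul, ← mul_assoc]
  exact mul_le_mul_of_nonneg_right (norm_symb_le i z hξ) (norm_nonneg _)

theorem rpow_le_add_rpow {t a b c : ℝ} (ht : 0 < t) (hac : a ≤ c) (hcb : c ≤ b) :
    t ^ c ≤ t ^ a + t ^ b := by
  have ha : 0 < t ^ a := by positivity
  have hb : 0 < t ^ b := by positivity
  rcases le_total 1 t with h | h
  · linarith [Real.rpow_le_rpow_of_exponent_le h hcb]
  · linarith [Real.rpow_le_rpow_of_exponent_ge ht h hac]

theorem differentiableAt_integral_symb (hm : 1 ≤ m) (i : Option (Fin m)) {z₀ : ℂ}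
    (hz : -(m : ℝ) < z₀.re) (g : 𝓢(Euc m, ℂ)) :
    DifferentiableAt ℂ (fun z => ∫ ξ, symb i z ξ * g ξ) z₀ := by
  obtain ⟨a, ha, ha'⟩ := exists_between hz
  have h2pi : 0 < 2 * Real.pi := by have := Real.pi_pos; positivity
  refine differentiableAt_integral
    -- The sum of the two extreme powers dominates every power between them, both near `0` and near
    -- infinity.
    (bound := fun ξ => (2 * Real.pi) ^ a * (‖ξ‖ ^ a * ‖g ξ‖) +
      (2 * Real.pi) ^ (z₀.re + 1) * (‖ξ‖ ^ (z₀.re + 1) * ‖g ξ‖))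
    (Eventually.of_forall fun z =>
      ((measurable_symb i z).mul g.continuous.measurable).aestronglyMeasurable)
    (((integrable_norm_rpow_mul hm ha g).const_mul _).add
      ((integrable_norm_rpow_mul hm (by linarith) g).const_mul _))
    ⟨{z | a < z.re ∧ z.re < z₀.re + 1}, ?_, ?_⟩
  · exact ((isOpen_lt continuous_const Complex.continuous_re).inter
      (isOpen_lt Complex.continuous_re continuous_const)).mem_nhds ⟨ha', by simp⟩
  · filter_upwards [ae_ne_zero hm] with ξ hξ z hz'
    have hξ0 : 0 < ‖ξ‖ := norm_pos_iff.mpr hξ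
    constructor
    · have h1 : (2 * Real.pi : ℂ) ≠ 0 := by exact_mod_cast h2pi.ne'
      have h2 : (‖ξ‖ : ℂ) ≠ 0 := by exact_mod_cast hξ0.ne'
      unfold symb
      refine DifferentiableAt.mul_const (DifferentiableAt.mul (DifferentiableAt.mul_const
        (differentiableAt_id.const_cpow (Or.inl h1)) _) (DifferentiableAt.mul_const ?_ _)) _
      exact (differentiableAt_id.sub_const _).const_cpow (Or.inl h2)
    · rw [norm_mul, ← mul_assoc, ← mul_assoc, ← add_mul]
      refine mul_le_mul_of_nonneg_right ((norm_symb_le i z hξ).trans ?_) (norm_nonneg _)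
      rw [← Real.mul_rpow h2pi.le hξ0.le, ← Real.mul_rpow h2pi.le hξ0.le,
        ← Real.mul_rpow h2pi.le hξ0.le]
      exact rpow_le_add_rpow (by positivity) hz'.1.le hz'.2.le

theorem mem_dom_of_im_ne_zero (i : Option (Fin m)) {z : ℂ} (hz : z.im ≠ 0) : z ∈ dom i := by
  refine ⟨fun l h => hz ?_, fun n h => hz ?_⟩
  · rw [h]; simp
  · rw [h]; simp

/-- All points outside `dom i` are real, so both sides are holomorphic on the connected set `Re z >
-1`, `Im z > 0`; they agree where moreover `Re z < 0`. -/
theorem reg_eq_integral (hm : 1 ≤ m) (i : Option (Fin m)) {z : ℂ} (hz : -1 < z.re)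
    (hz' : 0 < z.im) (φ : 𝓢(Euc m, ℂ)) (y : Euc m) :
    reg i z φ y = ∫ ξ : Euc m, symb i z ξ * (𝓕⁻ (reflectAt y φ)) ξ := by
  have hm1 : (1 : ℝ) ≤ m := by exact_mod_cast hm
  set V : Set ℂ := {z | -1 < z.re ∧ 0 < z.im} with hV
  have hVo : IsOpen V := (isOpen_lt continuous_const Complex.continuous_re).inter
    (isOpen_lt continuous_const Complex.continuous_im)
  have hVc : IsPreconnected V :=
    ((convex_halfSpace_re_gt (-1)).inter (convex_halfSpace_im_gt 0)).isPreconnected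
  have h1 : AnalyticOnNhd ℂ (fun z => reg i z φ y) V :=
    DifferentiableOn.analyticOnNhd (fun z hz => (differentiableAt_reg i
      (mem_dom_of_im_ne_zero i hz.2.ne') φ y).differentiableWithinAt) hVo
  have h2 : AnalyticOnNhd ℂ (fun z => ∫ ξ : Euc m, symb i z ξ * (𝓕⁻ (reflectAt y φ)) ξ) V :=
    DifferentiableOn.analyticOnNhd (fun z hz => (differentiableAt_integral_symb hm i
      (by linarith [hz.1]) _).differentiableWithinAt) hVo
  set z₀ : ℂ := ⟨-(1 / 2), 1⟩ with hz₀
  have hz₀V : z₀ ∈ V := ⟨by norm_num [hz₀], by norm_num [hz₀]⟩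
  refine h1.eqOn_of_preconnected_of_eventuallyEq h2 hVc hz₀V ?_ ⟨hz, hz'⟩
  have hW : {z : ℂ | z.re < 0} ∈ 𝓝 z₀ :=
    (isOpen_lt Complex.continuous_re continuous_const).mem_nhds (by norm_num [hz₀])
  filter_upwards [hW, hVo.mem_nhds hz₀V] with z hz1 hz2
  exact reg_eq_integral_of_neg hm i hz1 hz2.1 φ y

theorem symb_zero (i : Option (Fin m)) {z : ℂ} (hz : z ≠ 0) : symb i z 0 = 0 := by
  cases i with
  | none => simp [symb, deg, hz]
  | some j => simp [symb, wt]

theorem continuous_symb (i : Option (Fin m)) {z : ℂ} (hz : 0 < z.re) : Continuous (symb i z) := by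
  rw [continuous_iff_continuousAt]
  intro ξ
  by_cases hξ : ξ = 0
  · subst hξ
    have h0 : symb i z 0 = 0 := symb_zero i (by rintro rfl; simp at hz)
    rw [ContinuousAt, h0]
    refine squeeze_zero_norm (a := fun ξ : Euc m => (2 * Real.pi) ^ z.re * ‖ξ‖ ^ z.re)
      (fun ξ => ?_) ?_
    · by_cases hξ : ξ = 0
      · rw [hξ, h0, norm_zero]
        have := Real.pi_pos
        positivity
      · exact norm_symb_le i z hξ
    · have : Continuous fun ξ : Euc m => (2 * Real.pi) ^ z.re * ‖ξ‖ ^ z.re :=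
        continuous_const.mul (continuous_norm.rpow_const fun _ => Or.inr hz.le)
      have h1 := this.tendsto 0
      rwa [norm_zero, Real.zero_rpow hz.ne', mul_zero] at h1
  · have hξ0 : ‖ξ‖ ≠ 0 := norm_ne_zero_iff.mpr hξ
    unfold symb
    refine continuousAt_const.mul (ContinuousAt.mul ?_ (continuous_wt i).continuousAt)
    exact ContinuousAt.comp (f := fun ξ : Euc m => ‖ξ‖)
      (Complex.continuousAt_ofReal_cpow_const _ _ (Or.inr hξ0)) continuous_norm.continuousAt

/-! ### Convolution of two components with opposite exponents. -/

/-- The character `exp (2π i ⟨x, ξ⟩)`. -/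
def character (x ξ : Euc m) : ℂ :=
  Complex.exp (((2 * Real.pi * inner ℝ x ξ : ℝ) : ℂ) * Complex.I)

theorem norm_character (x ξ : Euc m) : ‖character x ξ‖ = 1 := Complex.norm_exp_ofReal_mul_I _

theorem continuous_character (x : Euc m) : Continuous (character x) := by
  unfold character
  fun_prop

/-- The homogeneous symbol `1` or `i ξ_j / |ξ|`. -/
def dirSymb (i : Option (Fin m)) (ξ : Euc m) : ℂ :=
  Complex.I ^ deg i * (wt i ξ / (‖ξ‖ : ℂ) ^ deg i)

theorem symb_mul_symb_neg (i i' : Option (Fin m)) (z : ℂ) {ξ : Euc m} (hξ : ξ ≠ 0) :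
    symb i z ξ * symb i' (-z) ξ = dirSymb i ξ * dirSymb i' ξ := by
  have hξ0 : (‖ξ‖ : ℂ) ≠ 0 := by exact_mod_cast norm_ne_zero_iff.mpr hξ
  have h2pi : (2 * Real.pi : ℂ) ≠ 0 := by
    have := Real.pi_ne_zero
    simp [this]
  have h1 : (2 * Real.pi : ℂ) ^ z * (2 * Real.pi : ℂ) ^ (-z) = 1 := by
    rw [← Complex.cpow_add _ _ h2pi, add_neg_cancel, Complex.cpow_zero]
  have h2 : (‖ξ‖ : ℂ) ^ (z - deg i) * (‖ξ‖ : ℂ) ^ (-z - deg i') =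
      ((‖ξ‖ : ℂ) ^ deg i)⁻¹ * ((‖ξ‖ : ℂ) ^ deg i')⁻¹ := by
    rw [Complex.cpow_sub _ _ hξ0, Complex.cpow_sub _ _ hξ0, Complex.cpow_neg, Complex.cpow_natCast,
      Complex.cpow_natCast]
    have : (‖ξ‖ : ℂ) ^ z ≠ 0 := by simp [Complex.cpow_eq_zero_iff, hξ0]
    field_simp
  calc symb i z ξ * symb i' (-z) ξ
      = ((2 * Real.pi : ℂ) ^ z * (2 * Real.pi : ℂ) ^ (-z)) * (Complex.I ^ deg i * Complex.I ^ deg i') *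
        (((‖ξ‖ : ℂ) ^ (z - deg i) * (‖ξ‖ : ℂ) ^ (-z - deg i')) * (wt i ξ * wt i' ξ)) := by
        rw [symb, symb]; ring
    _ = _ := by rw [h1, h2, dirSymb, dirSymb, div_eq_mul_inv, div_eq_mul_inv]; ring

/-- The Fourier representation of the convolution of two kernels with opposite exponents. -/
def pairInt (i i' : Option (Fin m)) (φ ψ : 𝓢(Euc m, ℂ)) (x : Euc m) : ℂ :=
  ∫ ξ, dirSymb i ξ * dirSymb i' ξ * ((𝓕 φ) ξ * (𝓕 ψ) ξ * character x ξ)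

/-- The decay exponents `m + Re z₀ - 1/4` and `m - Re z₀ - 1/4` add up to `2m - 1/2`, independently
of `z₀`. Peetre's inequality replaces `x - y` by `y` at the cost of a factor depending on `x`. As `m
≥ 1`, the sum exceeds `m`. -/
theorem exists_bound_pair (hm : 1 ≤ m) (i i' : Option (Fin m)) {z₀ : ℂ} (hz₀ : z₀ ∈ dom i)
    (hz₀' : -z₀ ∈ dom i') (φ ψ : 𝓢(Euc m, ℂ)) (x : Euc m) :
    ∃ C : ℝ, ∀ᶠ z in 𝓝 z₀, ∀ y : Euc m,
      ‖reg i z φ y * reg i' (-z) ψ (x - y)‖ ≤ C * (1 + ‖y‖) ^ (-(2 * (m : ℝ) - 1 / 2)) := by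
  obtain ⟨C, K, N, hC, h⟩ := exists_norm_reg_le hm i hz₀ (ε := 1 / 4) (by norm_num)
  obtain ⟨C', K', N', hC', h'⟩ := exists_norm_reg_le hm i' hz₀' (ε := 1 / 4) (by norm_num)
  set s : ℝ := -(m + (-z₀).re - 1 / 4) with hs
  refine ⟨(C * snorm K N φ) * (C' * snorm K' N' ψ * (1 + ‖x‖) ^ |s|), ?_⟩
  have hneg : Tendsto (fun z : ℂ => -z) (𝓝 z₀) (𝓝 (-z₀)) := continuous_neg.tendsto z₀
  filter_upwards [h, hneg.eventually h'] with z h1 h2 y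
  have h3 := rpow_one_add_norm_le s (x - y) (-y)
  rw [norm_neg, show -y - (x - y) = -x by abel, norm_neg] at h3
  have hn := mul_nonneg hC (snorm_nonneg K N φ)
  have hn' := mul_nonneg hC' (snorm_nonneg K' N' ψ)
  rw [norm_mul]
  calc _ ≤ (C * snorm K N φ * (1 + ‖y‖) ^ (-(m + z₀.re - 1 / 4))) *
        (C' * snorm K' N' ψ * ((1 + ‖y‖) ^ s * (1 + ‖x‖) ^ |s|)) :=
        mul_le_mul (h1 φ y) ((h2 ψ (x - y)).trans (mul_le_mul_of_nonneg_left h3 hn'))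
          (norm_nonneg _) (mul_nonneg hn (by positivity))
    _ = (C * snorm K N φ) * (C' * snorm K' N' ψ * (1 + ‖x‖) ^ |s|) *
        ((1 + ‖y‖) ^ (-(m + z₀.re - 1 / 4)) * (1 + ‖y‖) ^ s) := by ring
    _ = _ := by
        rw [← Real.rpow_add (by positivity)]
        congr 2
        rw [hs, Complex.neg_re]; ring

theorem integrable_decay {a : ℝ} (ha : (m : ℝ) < a) :
    Integrable (fun y : Euc m => (1 + ‖y‖) ^ (-a)) :=
  integrable_one_add_norm (by simpa using ha)

theorem aestronglyMeasurable_pair (i i' : Option (Fin m)) (z : ℂ) (φ ψ : 𝓢(Euc m, ℂ)) (x : Euc m) :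
    AEStronglyMeasurable (fun y => reg i z φ y * reg i' (-z) ψ (x - y)) volume :=
  ((stronglyMeasurable_reg i z φ).mul
    ((stronglyMeasurable_reg i' (-z) ψ).comp_measurable (by fun_prop))).aestronglyMeasurable

theorem integrable_pair (hm : 1 ≤ m) (i i' : Option (Fin m)) {z : ℂ} (hz : z ∈ dom i)
    (hz' : -z ∈ dom i') (φ ψ : 𝓢(Euc m, ℂ)) (x : Euc m) :
    Integrable (fun y => reg i z φ y * reg i' (-z) ψ (x - y)) := by
  obtain ⟨C, h⟩ := exists_bound_pair hm i i' hz hz' φ ψ x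
  have hm1 : (1 : ℝ) ≤ m := by exact_mod_cast hm
  exact Integrable.mono' ((integrable_decay (a := 2 * (m : ℝ) - 1 / 2) (by linarith)).const_mul C)
    (aestronglyMeasurable_pair i i' z φ ψ x) (Eventually.of_forall h.self_of_nhds)

theorem differentiableAt_integral_pair (hm : 1 ≤ m) (i i' : Option (Fin m)) {z₀ : ℂ}
    (hz : z₀ ∈ dom i ∧ -z₀ ∈ dom i')
    (hnhds : {z | z ∈ dom i ∧ -z ∈ dom i'} ∈ 𝓝 z₀) (φ ψ : 𝓢(Euc m, ℂ)) (x : Euc m) :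
    DifferentiableAt ℂ (fun z => ∫ y, reg i z φ y * reg i' (-z) ψ (x - y)) z₀ := by
  obtain ⟨C, h⟩ := exists_bound_pair hm i i' hz.1 hz.2 φ ψ x
  have hm1 : (1 : ℝ) ≤ m := by exact_mod_cast hm
  refine differentiableAt_integral
    (Eventually.of_forall fun z => aestronglyMeasurable_pair i i' z φ ψ x)
    ((integrable_decay (a := 2 * (m : ℝ) - 1 / 2) (by linarith)).const_mul C)
    ⟨_, inter_mem h hnhds, Eventually.of_forall fun y z hz => ⟨?_, hz.1 y⟩⟩
  refine (differentiableAt_reg i hz.2.1 φ y).mul ?_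
  exact DifferentiableAt.comp z (differentiableAt_reg i' hz.2.2 ψ (x - y))
    differentiable_neg.differentiableAt

/-- In this strip the two factors play different roles. The kernel of exponent `z` gives an
integrable function whose Fourier transform is the continuous function `G`. The one of exponent `-z`
is the Fourier transform of an integrable `H`, its symbol being singular only at the origin. Moving
the transform from one factor to the other multiplies the symbols, and the powers of `2π‖ξ‖` cancel.
-/
theorem integral_pair_of_strip (hm : 1 ≤ m) (i i' : Option (Fin m)) {z : ℂ} (h0 : 0 < z.re)
    (h1 : z.re < 1) (him : 0 < z.im) (φ ψ : 𝓢(Euc m, ℂ)) (x : Euc m) :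
    ∫ y, reg i z φ y * reg i' (-z) ψ (x - y) = pairInt i i' φ ψ x := by
  have hm1 : (1 : ℝ) ≤ m := by exact_mod_cast hm
  set G : Euc m → ℂ := fun ξ => symb i z ξ * (𝓕 φ) ξ with hG
  set H : Euc m → ℂ := fun ξ => symb i' (-z) ξ * (𝓕 ψ) ξ * character x ξ with hH
  have hGi : Integrable G := integrable_symb_mul hm i (by linarith) _
  have hGc : Continuous G := (continuous_symb i h0).mul (𝓕 φ).continuous
  have hHi : Integrable H := by
    refine (integrable_symb_mul hm i' (z := -z) (by simp; linarith) (𝓕 ψ)).mul_bdd (c := 1)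
      (continuous_character x).aestronglyMeasurable (Eventually.of_forall fun ξ => ?_)
    rw [norm_character]
  have hA : reg i z φ = 𝓕⁻ G := by
    ext y
    rw [reg_eq_integral hm i (by linarith) him, Real.fourierInv_eq']
    congr 1
    ext ξ
    rw [fourierInv_reflectAt, hG, real_inner_comm, smul_eq_mul]
    ring
  have hAi : Integrable (reg i z φ) := by
    obtain ⟨C, K, N, hC, h⟩ := exists_norm_reg_le hm i (mem_dom_of_im_ne_zero i him.ne')
      (ε := z.re / 2) (by linarith)
    exact Integrable.mono' ((integrable_decay (a := m + z.re - z.re / 2) (by linarith)).const_mul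
      (C * snorm K N φ)) (stronglyMeasurable_reg i z φ).aestronglyMeasurable
      (Eventually.of_forall fun y => h.self_of_nhds φ y)
  have hFA : 𝓕 (reg i z φ) = G := by
    rw [hA]
    -- Inversion also needs `𝓕 G` integrable; it is the reflection of `reg i z φ`, whose decay is
    -- already known.
    refine hGc.fourier_fourierInv_eq hGi ?_
    have : 𝓕 G = fun y => reg i z φ (-y) := by
      ext y
      rw [hA, Real.fourierInv_eq_fourier_neg, neg_neg]
    rw [this]
    exact hAi.comp_neg
  have hB : ∀ y, reg i' (-z) ψ (x - y) = 𝓕 H y := by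
    intro y
    rw [reg_eq_integral_of_neg hm i' (by simpa using h0) (by simpa using h1), Real.fourier_eq']
    congr 1
    ext ξ
    rw [fourierInv_reflectAt]
    simp only [hH, smul_eq_mul, character]
    have : Complex.exp (((2 * Real.pi * inner ℝ (x - y) ξ : ℝ) : ℂ) * Complex.I) =
        Complex.exp (((-2 * Real.pi * inner ℝ ξ y : ℝ) : ℂ) * Complex.I) *
        Complex.exp (((2 * Real.pi * inner ℝ x ξ : ℝ) : ℂ) * Complex.I) := by
      rw [← Complex.exp_add, inner_sub_left, real_inner_comm ξ y]
      congr 1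
      push_cast
      ring
    rw [this]
    ring
  have hflip := VectorFourier.integral_bilin_fourierIntegral_eq_flip (ContinuousLinearMap.mul ℂ ℂ)
    (L := innerₗ (Euc m)) (μ := volume) (ν := volume) Real.continuous_fourierChar continuous_inner
    hAi hHi
  have h2 : ∫ ξ, 𝓕 (reg i z φ) ξ * H ξ = ∫ y, reg i z φ y * 𝓕 H y := by
    simpa using! hflip
  simp_rw [hB]
  rw [← h2, hFA, pairInt]
  refine integral_congr_ae ?_
  filter_upwards [ae_ne_zero hm] with ξ hξ
  rw [← symb_mul_symb_neg i i' z hξ, hG, hH]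
  ring

/-- The convolution of two kernels with opposite exponents does not depend on the exponent. -/
theorem integral_pair (hm : 1 ≤ m) (i i' : Option (Fin m)) {z : ℂ} (hz : z ∈ dom i)
    (hz' : -z ∈ dom i') (φ ψ : 𝓢(Euc m, ℂ)) (x : Euc m) :
    ∫ y, reg i z φ y * reg i' (-z) ψ (x - y) = pairInt i i' φ ψ x := by
  set V : Set ℂ := {z | z ∈ dom i ∧ -z ∈ dom i'} with hV
  -- Only integers are excluded. Their discreteness makes `V` open, their countability makes it
  -- connected.
  have hVS : V = ((fun k : ℤ => (k : ℂ)) '' {k : ℤ | (k : ℂ) ∉ V})ᶜ := by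
    ext w
    simp only [mem_compl_iff, mem_image, not_exists, not_and, mem_ofPred_eq]
    constructor
    · rintro hw k hk rfl
      exact hk hw
    · intro h
      by_contra hw
      have hint : ∃ k : ℤ, (k : ℂ) = w := by
        by_contra hk
        push Not at hk
        refine hw ⟨⟨fun l hl => hk (deg i + 2 * l) ?_, fun n hn => hk (-(m + deg i + 2 * n)) ?_⟩,
          ⟨fun l hl => hk (-(deg i' + 2 * l)) ?_, fun n hn => hk (m + deg i' + 2 * n) ?_⟩⟩
        · rw [hl]; push_cast; ring
        · rw [hn]; push_cast; ring
        · rw [← neg_neg w, hl]; push_cast; ring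
        · rw [← neg_neg w, hn]; push_cast; ring
      obtain ⟨k, rfl⟩ := hint
      exact h k hw rfl
  have hVo : IsOpen V := by
    rw [hVS, isOpen_compl_iff]
    have h1 : Topology.IsClosedEmbedding (fun k : ℤ => ((k : ℝ) : ℂ)) :=
      Complex.isometry_ofReal.isClosedEmbedding.comp Int.isClosedEmbedding_coe_real
    have h2 : (fun k : ℤ => (k : ℂ)) = fun k : ℤ => ((k : ℝ) : ℂ) := by ext k; simp
    rw [h2]
    exact h1.isClosedMap _ (isClosed_discrete _)
  have hVc : IsPreconnected V := by
    rw [hVS]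
    exact (Set.Countable.isConnected_compl_of_one_lt_rank (by simp)
      ((Set.to_countable _).image _)).isPreconnected
  have h1 : AnalyticOnNhd ℂ (fun z => ∫ y, reg i z φ y * reg i' (-z) ψ (x - y)) V :=
    DifferentiableOn.analyticOnNhd (fun z hz => (differentiableAt_integral_pair hm i i' hz
      (hVo.mem_nhds hz) φ ψ x).differentiableWithinAt) hVo
  set z₀ : ℂ := ⟨1 / 2, 1⟩ with hz₀
  have hz₀V : z₀ ∈ V := ⟨mem_dom_of_im_ne_zero i (by norm_num [hz₀]),
    mem_dom_of_im_ne_zero i' (by norm_num [hz₀])⟩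
  refine h1.eqOn_of_preconnected_of_eventuallyEq (analyticOnNhd_const (v := pairInt i i' φ ψ x))
    hVc hz₀V ?_ ⟨hz, hz'⟩
  have hW : {z : ℂ | (0 < z.re ∧ z.re < 1) ∧ 0 < z.im} ∈ 𝓝 z₀ :=
    (((isOpen_lt continuous_const Complex.continuous_re).inter
      (isOpen_lt Complex.continuous_re continuous_const)).inter
      (isOpen_lt continuous_const Complex.continuous_im)).mem_nhds
      ⟨⟨by norm_num [hz₀], by norm_num [hz₀]⟩, by norm_num [hz₀]⟩
  filter_upwards [hW] with z hz
  exact integral_pair_of_strip hm i i' hz.1.1 hz.1.2 hz.2 φ ψ x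

/-! ### From the components back to the Clifford-valued kernels. -/

/-- The coefficients of the scalar and of the vector part of the symbol of `∂^μ H`. -/
def symbCoeff (i : Option (Fin m)) (μ : ℂ) : ℂ :=
  i.elim ((1 - Complex.exp (Complex.I * Real.pi * μ)) / 2)
    (fun _ => (1 + Complex.exp (Complex.I * Real.pi * μ)) / 2)

/-- The Clifford elements `1, e_1, …, e_m`. -/
def gen (i : Option (Fin m)) : Cliff m := i.elim 1 e

/-- The Schwartz function `x ↦ χ (-x)`. -/
def negTest : 𝓢(Euc m, ℂ) →L[ℂ] 𝓢(Euc m, ℂ) :=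
  SchwartzMap.compCLMOfContinuousLinearEquiv ℂ (ContinuousLinearEquiv.neg ℝ)

theorem negTest_apply (χ : 𝓢(Euc m, ℂ)) (x : Euc m) : negTest χ x = χ (-x) := by
  simp [negTest]

theorem mean_negTest_reflectAt (i : Option (Fin m)) (φ : 𝓢(Euc m, ℂ)) (y : Euc m) :
    mean i (negTest (reflectAt y φ)) 0 = mean i φ y := by
  ext r
  simp [mean, negTest_apply, reflectAt_apply]

theorem reg_negTest_reflectAt (i : Option (Fin m)) (z : ℂ) (φ : 𝓢(Euc m, ℂ)) (y : Euc m) :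
    reg i z (negTest (reflectAt y φ)) 0 = reg i z φ y := by
  rw [reg, rawReg, mean_negTest_reflectAt, reg, rawReg]

theorem sphereArea_ne_zero (hm : 1 ≤ m) : (sphereArea m : ℂ) ≠ 0 := by
  have h1 : 0 < (m : ℝ) / 2 := by
    have : (0 : ℝ) < m := by exact_mod_cast hm
    positivity
  have h2 := Real.Gamma_pos_of_pos h1
  have h3 : 0 < sphereArea m := by
    unfold sphereArea
    have := Real.pi_pos
    positivity
  exact_mod_cast h3.ne'

theorem T_eq (hm : 1 ≤ m) (μ : ℂ) (χ : 𝓢(Euc m, ℂ)) :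
    T m (-m - μ) χ = rawReg none μ (negTest χ) 0 := by
  have h1 : sphMean χ = fun r => ((sphereArea m : ℂ))⁻¹ * mean none (negTest χ) 0 r := by
    ext r
    simp [sphMean, mean, wt, negTest_apply]
  have h2 : (-(m : ℂ) - μ + m - 1) = -μ - 1 := by ring
  rw [T, h1, finitePart_const_mul, h2, ← mul_assoc, mul_inv_cancel₀ (sphereArea_ne_zero hm), one_mul,
    rawReg]

theorem U_eq (hm : 1 ≤ m) (μ : ℂ) (χ : 𝓢(Euc m, ℂ)) :
    U m (-m - μ) χ = ∑ j : Fin m, rawReg (some j) μ (negTest χ) 0 • e j := by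
  have h2 : (-(m : ℂ) - μ + m - 1) = -μ - 1 := by ring
  rw [U]
  refine Finset.sum_congr rfl fun j _ => ?_
  have h1 : sphMeanVec j χ = fun r => ((sphereArea m : ℂ))⁻¹ * mean (some j) (negTest χ) 0 r := by
    ext r
    simp [sphMeanVec, mean, wt, negTest_apply]
  rw [h1, finitePart_const_mul, h2, ← mul_assoc, mul_inv_cancel₀ (sphereArea_ne_zero hm), one_mul,
    rawReg]

theorem exp_even (k : ℤ) : Complex.exp (Complex.I * Real.pi * (2 * k : ℂ)) = 1 := by
  rw [Complex.exp_eq_one_iff]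
  exact ⟨k, by ring⟩

theorem exp_odd (k : ℤ) : Complex.exp (Complex.I * Real.pi * (2 * k + 1 : ℂ)) = -1 := by
  rw [mul_add, Complex.exp_add, exp_even, one_mul, mul_one, mul_comm, Complex.exp_pi_mul_I]

/-- Nonnegative `k` covers the poles of the finite part; negative `k` is needed for the Gamma poles
when `m` is even. -/
theorem symbCoeff_eq_zero (i : Option (Fin m)) (k : ℤ) : symbCoeff i (deg i + 2 * k) = 0 := by
  cases i with
  | none => simp [symbCoeff, deg, exp_even]
  | some j =>
    have := exp_odd k
    simp only [symbCoeff, deg, Option.elim, Nat.cast_one, add_comm (1 : ℂ) (2 * k)]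
    rw [this]
    simp

/-- The coefficient vanishes at every integer of the parity of `deg i`, in particular at all poles
of the finite part. The Gamma poles `-(m + deg i + 2n)` have this parity when `m` is even; when `m`
is odd they are excluded by `hμ`. -/
theorem mem_dom_of_symbCoeff_ne_zero (i : Option (Fin m)) {μ : ℂ}
    (hμ : Odd m → ∀ n : ℕ, μ ≠ -((m : ℂ) + n)) (h : symbCoeff i μ ≠ 0) : μ ∈ dom i := by
  refine ⟨fun l hl => h ?_, fun n hn => ?_⟩
  · rw [hl]
    exact_mod_cast symbCoeff_eq_zero i l
  · rcases Nat.even_or_odd m with he | ho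
    · obtain ⟨k, hk⟩ := he
      refine h ?_
      have h1 := symbCoeff_eq_zero i (-(k + deg i + n))
      have h2 : μ = deg i + 2 * ((-(k + deg i + n) : ℤ) : ℂ) := by
        have hk' : (m : ℂ) = k + k := by exact_mod_cast hk
        rw [hn, hk']; push_cast; ring
      rw [h2]
      exact h1
    · refine hμ ho (deg i + 2 * n) ?_
      rw [hn]; push_cast; ring

/-- The exceptional branch of `Tstar` occurs only for `μ = 2 * l`, where the coefficient is zero;
elsewhere the powers of `π` and the Gamma factors combine to `cst`. -/
theorem coeffT_mul_Tstar (hm : 1 ≤ m) (μ : ℂ) (χ : 𝓢(Euc m, ℂ)) :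
    coeffT m μ * Tstar m (-m - μ) χ =
      symbCoeff (none : Option (Fin m)) μ * reg none μ (negTest χ) 0 := by
  by_cases h : symbCoeff (none : Option (Fin m)) μ = 0
  · have h1 : (1 - Complex.exp (Complex.I * Real.pi * μ)) / 2 = 0 := h
    rw [coeffT, h1, h]
    simp
  · have hne : ¬ ∃ l : ℕ, -(m : ℂ) - μ = -(m : ℂ) - 2 * l := by
      rintro ⟨l, hl⟩
      refine h ?_
      have h2 : μ = (deg (none : Option (Fin m)) : ℂ) + 2 * ((l : ℤ) : ℂ) := by
        simp only [deg, Option.elim, Nat.cast_zero, zero_add, Int.cast_natCast]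
        linear_combination -hl
      rw [h2]
      exact symbCoeff_eq_zero none l
    have hpi : (Real.pi : ℂ) ≠ 0 := by exact_mod_cast Real.pi_ne_zero
    have e1 : (-(m : ℂ) - μ + m) / 2 = (0 - μ) / 2 := by ring
    have e2 : (Real.pi : ℂ) ^ ((0 - μ) / 2) =
        (Real.pi : ℂ) ^ (-((m : ℂ) / 2)) * (Real.pi : ℂ) ^ (((m : ℂ) - μ) / 2) := by
      rw [← Complex.cpow_add _ _ hpi]
      congr 1
      ring
    have e3 : (Real.pi : ℂ) ^ (((m : ℂ) - μ) / 2) ≠ 0 := by simp [Complex.cpow_eq_zero_iff, hpi]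
    rw [Tstar, dif_neg hne, T_eq hm, e1, e2, coeffT, reg, cst]
    simp only [symbCoeff, deg, Option.elim, pow_zero, Nat.cast_zero, add_zero]
    field_simp

theorem coeffU_smul_Ustar (hm : 1 ≤ m) (μ : ℂ) (χ : 𝓢(Euc m, ℂ)) :
    coeffU m μ • Ustar m (-m - μ) χ =
      -∑ j : Fin m, (symbCoeff (some j) μ * reg (some j) μ (negTest χ) 0) • e j := by
  -- Any index serves: the coefficient is the same for all vector components.
  have j₀ : Fin m := ⟨0, hm⟩
  by_cases h : (1 + Complex.exp (Complex.I * Real.pi * μ)) / 2 = 0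
  · have h1 : ∀ j : Fin m, symbCoeff (some j) μ = 0 := fun j => h
    rw [coeffU, h]
    simp [h1]
  · have hne : ¬ ∃ l : ℕ, -(m : ℂ) - μ = -(m : ℂ) - 2 * l - 1 := by
      rintro ⟨l, hl⟩
      refine h ?_
      have h2 : μ = (deg (some j₀) : ℂ) + 2 * ((l : ℤ) : ℂ) := by
        simp only [deg, Option.elim, Nat.cast_one, Int.cast_natCast]
        linear_combination -hl
      rw [h2]
      exact symbCoeff_eq_zero (some j₀) l
    have hpi : (Real.pi : ℂ) ≠ 0 := by exact_mod_cast Real.pi_ne_zero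
    have e1 : (-(m : ℂ) - μ + m + 1) / 2 = (1 - μ) / 2 := by ring
    have e2 : (Real.pi : ℂ) ^ ((1 - μ) / 2) =
        (Real.pi : ℂ) ^ (-((m : ℂ) / 2)) * (Real.pi : ℂ) ^ (((m : ℂ) - μ + 1) / 2) := by
      rw [← Complex.cpow_add _ _ hpi]
      congr 1
      ring
    have e3 : (Real.pi : ℂ) ^ (((m : ℂ) - μ + 1) / 2) ≠ 0 := by simp [Complex.cpow_eq_zero_iff, hpi]
    rw [Ustar, dif_neg hne, U_eq hm, e1, e2, coeffU, smul_smul, Finset.smul_sum,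
      ← Finset.sum_neg_distrib]
    refine Finset.sum_congr rfl fun j _ => ?_
    rw [smul_smul, ← neg_smul, reg, cst]
    congr 1
    simp only [symbCoeff, deg, Option.elim, pow_one, Nat.cast_one]
    field_simp

/-- The kernel `∂^μ H` in terms of the normalized kernels. -/
theorem diracPowH_eq (hm : 1 ≤ m) (μ : ℂ) (χ : 𝓢(Euc m, ℂ)) :
    diracPowH m μ χ =
      ∑ i : Option (Fin m), (symbCoeff i μ * reg i μ (negTest χ) 0) • gen i := by
  rw [diracPowH, coeffT_mul_Tstar hm, coeffU_smul_Ustar hm, sub_neg_eq_add, Fintype.sum_option,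
    Algebra.algebraMap_eq_smul_one]
  rfl

theorem regularize_diracPowH (hm : 1 ≤ m) (μ : ℂ) (φ : 𝓢(Euc m, ℂ)) (y : Euc m) :
    regularize (diracPowH m μ) φ y =
      ∑ i : Option (Fin m), (symbCoeff i μ * reg i μ φ y) • gen i := by
  rw [regularize, diracPowH_eq hm]
  simp_rw [reg_negTest_reflectAt]

theorem isTempered_diracPowH (hm : 1 ≤ m) {μ : ℂ}
    (hμ : Odd m → ∀ n : ℕ, μ ≠ -((m : ℂ) + n)) : IsTempered (diracPowH m μ) := by
  intro l
  have hB : ∀ i : Option (Fin m), ∃ B : 𝓢(Euc m, ℂ) →L[ℂ] ℂ, ∀ χ,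
      symbCoeff i μ * reg i μ (negTest χ) 0 = B χ := by
    intro i
    by_cases h : symbCoeff i μ = 0
    · exact ⟨0, fun χ => by simp [h]⟩
    · obtain ⟨A, hA⟩ := exists_rawReg_clm hm i (mem_dom_of_symbCoeff_ne_zero i hμ h).1
      refine ⟨(symbCoeff i μ * cst i μ) • A.comp negTest, fun χ => ?_⟩
      simp [hA, reg, mul_assoc]
  choose B hB using hB
  refine ⟨ContinuousLinearMap.toPointwiseConvergenceCLM _ _ _ _ (∑ i, l (gen i) • B i),
    fun χ => ?_⟩
  rw [diracPowH_eq hm, map_sum]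
  change _ = (∑ i, l (gen i) • B i) χ
  simp [hB, mul_comm]

theorem apply_algebraMap (l : Module.Dual ℂ (Cliff m)) (c : ℂ) :
    l (algebraMap ℂ (Cliff m) c) = c * l 1 := by
  rw [Algebra.algebraMap_eq_smul_one, map_smul, smul_eq_mul]

theorem isTempered_delta : IsTempered (delta m) := by
  intro l
  refine ⟨l 1 • TemperedDistribution.delta 0, fun χ => ?_⟩
  rw [delta, apply_algebraMap, mul_comm]
  rfl

theorem sum_smul_e (x : Euc m) :
    ∑ j : Fin m, ((x j : ℝ) : ℂ) • (e j : Cliff m) =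
      (1 : ℂ) ⊗ₜ[ℝ] CliffordAlgebra.ι (quadForm m) (x : Fin m → ℝ) := by
  have h1 : (x : Fin m → ℝ) = ∑ j : Fin m, x j • (Pi.single j (1 : ℝ) : Fin m → ℝ) := by
    ext k
    simp [Finset.sum_apply, Pi.single_apply]
  conv_rhs => rw [h1, map_sum, TensorProduct.tmul_sum]
  refine Finset.sum_congr rfl fun j _ => ?_
  rw [map_smul, e, TensorProduct.smul_tmul', ← TensorProduct.smul_tmul]
  congr 1

theorem sum_smul_e_sq (x : Euc m) :
    (∑ j : Fin m, ((x j : ℝ) : ℂ) • (e j : Cliff m)) * ∑ j : Fin m, ((x j : ℝ) : ℂ) • e j =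
      (-(‖x‖ : ℂ) ^ 2) • (1 : Cliff m) := by
  rw [sum_smul_e, Algebra.TensorProduct.tmul_mul_tmul, CliffordAlgebra.ι_sq_scalar, one_mul,
    Algebra.algebraMap_eq_smul_one]
  have h1 : quadForm m (x : Fin m → ℝ) = -‖x‖ ^ 2 := by
    rw [EuclideanSpace.norm_sq_eq]
    simp [QuadraticMap.weightedSumSquares_apply, pow_two]
  rw [h1, Algebra.TensorProduct.one_def, TensorProduct.smul_tmul', ← TensorProduct.smul_tmul]
  congr 1
  simp

/-- The symbols of `∂^μ H` and `∂^{-μ} H` are inverse to each other. -/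
theorem symbol_mul_symbol_neg (μ : ℂ) {ξ : Euc m} (hξ : ξ ≠ 0) :
    (∑ i : Option (Fin m), (symbCoeff i μ * dirSymb i ξ) • gen i) *
      ∑ i : Option (Fin m), (symbCoeff i (-μ) * dirSymb i ξ) • gen i = 1 := by
  have hξ0 : (‖ξ‖ : ℂ) ≠ 0 := by exact_mod_cast norm_ne_zero_iff.mpr hξ
  set v : Cliff m := ∑ j : Fin m, ((ξ j : ℝ) : ℂ) • (e j : Cliff m) with hv
  have hsum : ∀ ν : ℂ, ∑ i : Option (Fin m), (symbCoeff i ν * dirSymb i ξ) • gen i =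
      ((1 - Complex.exp (Complex.I * Real.pi * ν)) / 2) • (1 : Cliff m) +
      ((1 + Complex.exp (Complex.I * Real.pi * ν)) / 2 * (Complex.I / ‖ξ‖)) • v := by
    intro ν
    rw [Fintype.sum_option, hv, Finset.smul_sum]
    congr 1
    · simp [symbCoeff, dirSymb, gen, deg, wt]
    · refine Finset.sum_congr rfl fun j _ => ?_
      rw [smul_smul]
      simp only [symbCoeff, dirSymb, gen, deg, wt, Option.elim, pow_one]
      congr 1
      ring
  have hvv : v * v = (-(‖ξ‖ : ℂ) ^ 2) • (1 : Cliff m) := sum_smul_e_sq ξ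
  have hE : Complex.exp (Complex.I * Real.pi * μ) * Complex.exp (Complex.I * Real.pi * -μ) = 1 := by
    rw [← Complex.exp_add]; simp
  rw [hsum, hsum]
  generalize Complex.exp (Complex.I * Real.pi * μ) = E at hE ⊢
  generalize Complex.exp (Complex.I * Real.pi * -μ) = E' at hE ⊢
  -- Both symbols lie in the commutative subalgebra spanned by `1` and `v`, so only `v * v` has to
  -- be known. The two scalar identities below then rest on `E * E' = 1`.
  have key : ∀ a b c d : ℂ, (a • (1 : Cliff m) + b • v) * (c • (1 : Cliff m) + d • v) =
      (a * c - b * d * (‖ξ‖ : ℂ) ^ 2) • (1 : Cliff m) + (a * d + b * c) • v := fun a b c d => by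
    simp only [add_mul, mul_add, smul_mul_smul_comm, one_mul, mul_one, hvv, smul_smul]
    module
  have h1 : (1 - E) / 2 * ((1 - E') / 2) -
      (1 + E) / 2 * (Complex.I / ‖ξ‖) * ((1 + E') / 2 * (Complex.I / ‖ξ‖)) * (‖ξ‖ : ℂ) ^ 2 = 1 := by
    field_simp
    rw [Complex.I_sq]
    linear_combination 2 * hE
  have h2 : (1 - E) / 2 * ((1 + E') / 2 * (Complex.I / ‖ξ‖)) +
      (1 + E) / 2 * (Complex.I / ‖ξ‖) * ((1 - E') / 2) = 0 := by
    field_simp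
    linear_combination -2 * Complex.I * hE
  rw [key, h1, h2, one_smul, zero_smul, add_zero]

/-! ### The convolution identity. -/

theorem norm_dirSymb_le (i : Option (Fin m)) (ξ : Euc m) : ‖dirSymb i ξ‖ ≤ 1 := by
  rw [dirSymb, norm_mul, norm_pow, Complex.norm_I, one_pow, one_mul, norm_div, norm_pow,
    Complex.norm_real, norm_norm]
  exact div_le_one_of_le₀ (norm_wt_le i ξ) (by positivity)

theorem measurable_dirSymb (i : Option (Fin m)) : Measurable (dirSymb i) := by
  have h := continuous_wt i
  unfold dirSymb
  fun_prop

theorem integrable_fourier_mul (φ ψ : 𝓢(Euc m, ℂ)) (x : Euc m) :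
    Integrable (fun ξ => (𝓕 φ) ξ * (𝓕 ψ) ξ * character x ξ) := by
  have h1 : Integrable (fun ξ => (𝓕 φ) ξ * (𝓕 ψ) ξ) :=
    (𝓕 φ).integrable.mul_bdd (c := SchwartzMap.seminorm ℝ 0 0 (𝓕 ψ))
      (𝓕 ψ).continuous.aestronglyMeasurable
      (Eventually.of_forall fun ξ => by simpa using SchwartzMap.le_seminorm ℝ 0 0 (𝓕 ψ) ξ)
  exact h1.mul_bdd (c := 1) (continuous_character x).aestronglyMeasurable
    (Eventually.of_forall fun ξ => (norm_character x ξ).le)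

theorem integrable_pairInt (i i' : Option (Fin m)) (φ ψ : 𝓢(Euc m, ℂ)) (x : Euc m) :
    Integrable (fun ξ => dirSymb i ξ * dirSymb i' ξ *
      ((𝓕 φ) ξ * (𝓕 ψ) ξ * character x ξ)) := by
  refine (integrable_fourier_mul φ ψ x).bdd_mul (c := 1)
    ((measurable_dirSymb i).mul (measurable_dirSymb i')).aestronglyMeasurable
    (Eventually.of_forall fun ξ => ?_)
  rw [norm_mul]
  exact mul_le_one₀ (norm_dirSymb_le i ξ) (norm_nonneg _) (norm_dirSymb_le i' ξ)

/-- The convolution theorem for Schwartz functions. -/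
theorem integral_conv_eq (φ ψ : 𝓢(Euc m, ℂ)) (x : Euc m) :
    ∫ y, φ y * ψ (x - y) = ∫ ξ, (𝓕 φ) ξ * (𝓕 ψ) ξ * character x ξ := by
  have h := SchwartzMap.integral_fourier_mul_eq φ (𝓕⁻ (reflectAt x ψ))
  rw [FourierTransform.fourier_fourierInv_eq] at h
  simp_rw [reflectAt_apply, fourierInv_reflectAt] at h
  rw [← h]
  congr 1
  ext ξ
  rw [character]
  ring

/-- Expanding in the generators reduces everything to pairs of components. A pair with a vanishing
coefficient contributes zero; for the others `μ ∈ dom i` and `-μ ∈ dom i'`, so `integral_pair`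
applies. Summing under the frequency integral brings in the product of the two symbols, which is `1`
off the origin, and the convolution theorem for `φ` and `ψ` identifies the result. -/
theorem isConvolution_diracPowH (hm : 1 ≤ m) {μ : ℂ}
    (hμ : Odd m → ∀ n : ℕ, μ ≠ (m : ℂ) + n ∧ μ ≠ -((m : ℂ) + n)) :
    IsConvolution (diracPowH m μ) (diracPowH m (-μ)) (delta m) := by
  have hμ1 : Odd m → ∀ n : ℕ, μ ≠ -((m : ℂ) + n) := fun h n => (hμ h n).2
  -- The exclusion of `m + n` is what the second kernel, of exponent `-μ`, requires.
  have hμ2 : Odd m → ∀ n : ℕ, -μ ≠ -((m : ℂ) + n) := fun h n =>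
    fun h' => (hμ h n).1 (neg_injective h')
  have hd : ∀ i : Option (Fin m), symbCoeff i μ ≠ 0 → μ ∈ dom i :=
    fun i => mem_dom_of_symbCoeff_ne_zero i hμ1
  have hd' : ∀ i : Option (Fin m), symbCoeff i (-μ) ≠ 0 → -μ ∈ dom i :=
    fun i => mem_dom_of_symbCoeff_ne_zero i hμ2
  have hint : ∀ (φ ψ : 𝓢(Euc m, ℂ)) (x : Euc m) (i i' : Option (Fin m)) (c : ℂ),
      Integrable (fun y => symbCoeff i μ * reg i μ φ y *
        (symbCoeff i' (-μ) * reg i' (-μ) ψ (x - y)) * c) := by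
    intro φ ψ x i i' c
    by_cases h : symbCoeff i μ = 0
    · simp [h]
    by_cases h' : symbCoeff i' (-μ) = 0
    · simp [h']
    refine ((integrable_pair hm i i' (hd i h) (hd' i' h') φ ψ x).const_mul
      (symbCoeff i μ * symbCoeff i' (-μ) * c)).congr (Eventually.of_forall fun y => ?_)
    simp only
    ring
  refine ⟨isTempered_diracPowH hm hμ1, isTempered_diracPowH hm hμ2, isTempered_delta, ?_, ?_⟩
  · intro φ ψ x l l'
    have h : ∀ y, l (regularize (diracPowH m μ) φ y) *
        l' (regularize (diracPowH m (-μ)) ψ (x - y)) =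
        ∑ i : Option (Fin m), ∑ i' : Option (Fin m), symbCoeff i μ * reg i μ φ y *
        (symbCoeff i' (-μ) * reg i' (-μ) ψ (x - y)) * (l (gen i) * l' (gen i')) := by
      intro y
      rw [regularize_diracPowH hm, regularize_diracPowH hm, map_sum, map_sum, Finset.sum_mul_sum]
      refine Finset.sum_congr rfl fun i _ => Finset.sum_congr rfl fun i' _ => ?_
      rw [map_smul, map_smul, smul_eq_mul, smul_eq_mul]
      ring
    simp_rw [h]
    exact integrable_finsetSum _ fun i _ => integrable_finsetSum _ fun i' _ => hint φ ψ x i i' _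
  · intro φ ψ x l
    have hprod : ∀ s t : Option (Fin m) → ℂ,
        l ((∑ i, s i • gen i) * ∑ i, t i • gen i) =
        ∑ i, ∑ i', s i * t i' * l (gen i * gen i') := by
      intro s t
      rw [Finset.sum_mul_sum, map_sum]
      refine Finset.sum_congr rfl fun i _ => ?_
      rw [map_sum]
      refine Finset.sum_congr rfl fun i' _ => ?_
      rw [smul_mul_smul_comm, map_smul, smul_eq_mul]
    have hpair : ∀ i i' : Option (Fin m), ∫ y, symbCoeff i μ * reg i μ φ y *
        (symbCoeff i' (-μ) * reg i' (-μ) ψ (x - y)) * l (gen i * gen i') =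
        ∫ ξ, symbCoeff i μ * symbCoeff i' (-μ) * l (gen i * gen i') *
          (dirSymb i ξ * dirSymb i' ξ * ((𝓕 φ) ξ * (𝓕 ψ) ξ * character x ξ)) := by
      intro i i'
      by_cases h : symbCoeff i μ = 0
      · simp [h]
      by_cases h' : symbCoeff i' (-μ) = 0
      · simp [h']
      rw [integral_const_mul]
      change _ = _ * pairInt i i' φ ψ x
      rw [← integral_pair hm i i' (hd i h) (hd' i' h'), ← integral_const_mul]
      congr 1
      ext y
      ring
    have hL : ∫ y, l (regularize (delta m) φ y) * ψ (x - y) =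
        ∫ ξ, l 1 * ((𝓕 φ) ξ * (𝓕 ψ) ξ * character x ξ) := by
      rw [integral_const_mul, ← integral_conv_eq, ← integral_const_mul]
      congr 1
      ext y
      rw [regularize, delta, apply_algebraMap, reflectAt_apply, sub_zero]
      ring
    simp_rw [hL, regularize_diracPowH hm, hprod]
    rw [integral_finsetSum _ fun i _ => integrable_finsetSum _ fun i' _ => hint φ ψ x i i' _]
    have h1 : ∀ i : Option (Fin m), ∫ y, ∑ i' : Option (Fin m), symbCoeff i μ * reg i μ φ y *
        (symbCoeff i' (-μ) * reg i' (-μ) ψ (x - y)) * l (gen i * gen i') =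
        ∫ ξ, ∑ i', symbCoeff i μ * symbCoeff i' (-μ) * l (gen i * gen i') *
          (dirSymb i ξ * dirSymb i' ξ * ((𝓕 φ) ξ * (𝓕 ψ) ξ * character x ξ)) := by
      intro i
      rw [integral_finsetSum _ fun i' _ => hint φ ψ x i i' _,
        integral_finsetSum _ fun i' _ => (integrable_pairInt i i' φ ψ x).const_mul _]
      exact Finset.sum_congr rfl fun i' _ => hpair i i'
    simp_rw [h1]
    rw [← integral_finsetSum _ fun i _ => integrable_finsetSum _ fun i' _ =>
      (integrable_pairInt i i' φ ψ x).const_mul _]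
    refine integral_congr_ae ?_
    filter_upwards [ae_ne_zero hm] with ξ hξ
    rw [← symbol_mul_symbol_neg μ hξ, hprod, Finset.sum_mul]
    refine Finset.sum_congr rfl fun i _ => ?_
    rw [Finset.sum_mul]
    refine Finset.sum_congr rfl fun i' _ => ?_
    ring

theorem F_eq_diracPowH_neg (m : ℕ) (μ : ℂ) : F m μ = diracPowH m (-μ) := by
  ext φ
  have h1 : Complex.I * Real.pi * -μ = -(Complex.I * Real.pi * μ) := by ring
  have h2 : -(m : ℂ) - -μ = -m + μ := by ring
  have h3 : (m : ℂ) + -μ = m - μ := by ring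
  have h4 : (m : ℂ) - -μ = m + μ := by ring
  rw [F, diracPowH, coeffT, coeffU, h1, h2, h3, h4]

end HilbertDirac

end

theorem corollary5p1 (m : ℕ) (hm : 1 ≤ m) (μ : ℂ)
    (hμ : Odd m → ∀ n : ℕ, μ ≠ (m : ℂ) + n ∧ μ ≠ -((m : ℂ) + n)) :
    HilbertDirac.IsConvolution (HilbertDirac.diracPowH m μ) (HilbertDirac.diracPowH m (-μ))
        (HilbertDirac.delta m) ∧
      HilbertDirac.F m μ = HilbertDirac.diracPowH m (-μ) ∧
      HilbertDirac.IsFundamentalSolution m μ (HilbertDirac.F m μ) := by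
  have h := HilbertDirac.isConvolution_diracPowH hm hμ
  have hF := HilbertDirac.F_eq_diracPowH_neg m μ
  refine ⟨h, hF, ?_⟩
  rw [hF]
  exact h
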